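/- Let $n\ge 3$ and let $a,b$ be real numbers with $a<n$, $b<n$. Let $X=(x_1,\dots,x_n)$ be an i.i.d. sample from the bivariate normal distribution with means $\mu_1,\mu_2\in\mathbb R$, standard deviations $\sigma_1,\sigma_2>0$ and correlation $\rho\in(-1,1)$. Write $s_{ij}=\sum_{k}(x_{ik}-\bar x_i)(x_{jk}-\bar x_j)$, where $x_{ik}$ is the $i$-th coordinate of $x_k$ and $\bar x_i=n^{-1}\sum_k x_{ik}$, and $r=s_{12}/\sqrt{s_{11}s_{22}}$. Consider the improper prior density $$\pi_{ab}(\mu_1,\mu_2,\sigma_1,\sigma_2,\rho)=\frac{1}{\sigma_1^{3-a}\sigma_2^{2-b}(1-\rho^2)^{2-b/2}}$$ with respect to $d\mu_1\,d\mu_2\,d\sigma_1\,d\sigma_2\,d\rho$, and the regression coefficient $\theta_1=\rho\sigma_2/\sigma_1$. (a) If $s_{11}>0$, $s_{22}>0$ and $|r|<1$, then the posterior distribution given $X$ under $\pi_{ab}$ is a proper probability distribution, and the marginal posterior of $\theta_1$ is the law of $$\theta_1^*=\frac{r\sqrt{s_{22}}}{\sqrt{s_{11}}}-\frac{Z_3^*}{\sqrt{\chi^{2*}_{n-b}}}\,\frac{\sqrt{1-r^2}\,\sqrt{s_{22}}}{\sqrt{s_{11}}},$$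 where, for fixed $X$, $Z_3^*$ is standard normal, $\chi^{2*}_{n-b}$ is chi-squared with $n-b$ degrees of freedom, and the two are independent. Moreover, for each $\alpha\in(0,1)$ the posterior $(1-\alpha)$-quantile $(\theta_1^*)_{1-\alpha}$ is the unique $q$ such that $\theta_1<q$ has posterior probability $1-\alpha$. (b) For every $(\mu_1,\mu_2,\sigma_1,\sigma_2,\rho)$ as above and every $\alpha\in(0,1)$, the frequentist coverage of the one-sided credible interval $(-\infty,(\theta_1^*)_{1-\alpha})$ is $$P\bigl(\theta_1<(\theta_1^*)_{1-\alpha}\mid\mu_1,\mu_2,\sigma_1,\sigma_2,\rho\bigr)=P\Bigl(t_{n-2}<\sqrt{\tfrac{n-2}{n-b}}\,(t^*_{n-b})_{1-\alpha}\Bigr),$$ where $t_\nu$ is a Student $t$ variable with $\nu$ degrees of freedom and $(t^*_\nu)_{1-\alpha}$ is the $(1-\alpha)$-quantile of its distribution. In particular the coverage does not depend on $\rho$ (nor on $\mu_1,\mu_2,\sigma_1,\sigma_2$). It equals $1-\alpha$ for all $\alpha\in(0,1)$ if and only if $b=2$; more precisely, for a given $\alpha\in(0,1)$ it equals $1-\alpha$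 if and only if $b=2$ or $\alpha=1/2$. -/

import Mathlib

open MeasureTheory ProbabilityTheory

namespace BivariateNormal

noncomputable section

/-- Parameters `(μ₁, μ₂, σ₁, σ₂, ρ)`; `volume` on this type is `dμ₁ dμ₂ dσ₁ dσ₂ dρ`. -/
abbrev Param : Type := ℝ × ℝ × ℝ × ℝ × ℝ

/-- A sample of size `n` of points of the plane. -/
abbrev Sample (n : ℕ) : Type := Fin n → EuclideanSpace ℝ (Fin 2)

/-- The parameter space: `σ₁ > 0`, `σ₂ > 0`, `-1 < ρ < 1`. -/
def paramSpace : Set Param :=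
  {p | 0 < p.2.2.1 ∧ 0 < p.2.2.2.1 ∧ -1 < p.2.2.2.2 ∧ p.2.2.2.2 < 1}

/-- The regression coefficient `θ₁ = ρ σ₂ / σ₁`. -/
def theta1 (p : Param) : ℝ := p.2.2.2.2 * p.2.2.2.1 / p.2.2.1

/-- The mean vector `(μ₁, μ₂)`. -/
def meanVec (p : Param) : EuclideanSpace ℝ (Fin 2) := !₂[p.1, p.2.1]

/-- The covariance matrix `Σ` with standard deviations `σ₁, σ₂` and correlation `ρ`. -/
def covMatrix (p : Param) : Matrix (Fin 2) (Fin 2) ℝ :=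
  !![p.2.2.1 ^ 2, p.2.2.2.2 * p.2.2.1 * p.2.2.2.1;
     p.2.2.2.2 * p.2.2.1 * p.2.2.2.1, p.2.2.2.1 ^ 2]

/-- The sampling distribution: `n` independent `N₂((μ₁, μ₂), Σ)` observations. -/
def sampleLaw (n : ℕ) (p : Param) : Measure (Sample n) :=
  Measure.pi fun _ => multivariateGaussian (meanVec p) (covMatrix p)

/-- The Lebesgue density at `x` of the bivariate normal distribution with parameter
`(μ₁, μ₂, σ₁, σ₂, ρ)`. -/
def normalDensity (μ₁ μ₂ σ₁ σ₂ ρ : ℝ) (x : EuclideanSpace ℝ (Fin 2)) : ℝ :=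
  1 / (2 * Real.pi * σ₁ * σ₂ * √(1 - ρ ^ 2)) *
    Real.exp (-(1 / (2 * (1 - ρ ^ 2))) *
      (((x 0 - μ₁) / σ₁) ^ 2 - 2 * ρ * ((x 0 - μ₁) / σ₁) * ((x 1 - μ₂) / σ₂)
        + ((x 1 - μ₂) / σ₂) ^ 2))

/-- The likelihood function of the sample. -/
def likelihood {n : ℕ} (x : Sample n) (p : Param) : ℝ :=
  ∏ k, normalDensity p.1 p.2.1 p.2.2.1 p.2.2.2.1 p.2.2.2.2 (x k)

/-- The (improper) prior density `π_ab = 1 / (σ₁^(3-a) σ₂^(2-b) (1-ρ²)^(2-b/2))`. -/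
def priorDensity (a b : ℝ) (p : Param) : ℝ :=
  1 / (p.2.2.1 ^ (3 - a) * p.2.2.2.1 ^ (2 - b) * (1 - p.2.2.2.2 ^ 2) ^ (2 - b / 2))

/-- The measure with density `π_ab · likelihood` on the parameter space. -/
def unnormalizedPosterior (a b : ℝ) {n : ℕ} (x : Sample n) : Measure Param :=
  (volume.restrict paramSpace).withDensity fun p =>
    ENNReal.ofReal (priorDensity a b p * likelihood x p)

/-- The posterior distribution of `(μ₁, μ₂, σ₁, σ₂, ρ)` given the sample, under `π_ab`. -/
def posterior (a b : ℝ) {n : ℕ} (x : Sample n) : Measure Param :=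
  (unnormalizedPosterior a b x Set.univ)⁻¹ • unnormalizedPosterior a b x

/-- The marginal posterior distribution of `θ₁`. -/
def posteriorTheta1 (a b : ℝ) {n : ℕ} (x : Sample n) : Measure ℝ :=
  (posterior a b x).map theta1

/-- The sample mean of the `i`-th coordinate. -/
def sampleMean {n : ℕ} (x : Sample n) (i : Fin 2) : ℝ := (n : ℝ)⁻¹ * ∑ k, x k i

/-- The entries `s_ij` of the scatter matrix. -/
def scatter {n : ℕ} (x : Sample n) (i j : Fin 2) : ℝ :=
  ∑ k, (x k i - sampleMean x i) * (x k j - sampleMean x j)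

/-- The sample correlation coefficient `r`. -/
def sampleCorr {n : ℕ} (x : Sample n) : ℝ :=
  scatter x 0 1 / √(scatter x 0 0 * scatter x 1 1)

/-- The chi-squared distribution with `ν > 0` (real) degrees of freedom. -/
def chiSquared (ν : ℝ) : Measure ℝ := gammaMeasure (ν / 2) (1 / 2)

/-- Student's `t` distribution with `ν > 0` (real) degrees of freedom: the law of `Z / √(V / ν)`
with `Z` standard normal and `V` chi-squared with `ν` degrees of freedom, independent. -/
def studentT (ν : ℝ) : Measure ℝ :=
  ((gaussianReal 0 1).prod (chiSquared ν)).map fun z => z.1 / √(z.2 / ν)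

/-- The `u`-quantile of a distribution on `ℝ`. -/
def quantile (m : Measure ℝ) (u : ℝ) : ℝ := sInf {q | u ≤ m.real (Set.Iic q)}

/-- The frequentist coverage, at the true parameter `p` and for samples of size `n`, of the
one-sided credible interval `(-∞, (θ₁)_{1-α}(X))` for `θ₁` under `π_ab`. -/
def coverage (n : ℕ) (a b α : ℝ) (p : Param) : ℝ :=
  (sampleLaw n p).real {x | theta1 p < quantile (posteriorTheta1 a b x) (1 - α)}

end

end BivariateNormal

namespace BivariateNormal

open Set Filter Topology
open scoped NNReal ENNReal RealInnerProductSpace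

/-! ### Quantiles of atomless distributions with full support -/

section Quantile

/-! Replace `(σ₁, σ₂, ρ)` by the regression coordinates `σ₁`, `τ = σ₂√(1-ρ²)` and `θ = ρσ₂/σ₁`. The
likelihood is the normal likelihood of the first coordinate times that of the regression of the
second coordinate on the first. Put `D = s₂₂ - s₁₂²/s₁₁`. Prior, likelihood and Jacobian then
multiply to a product of kernels (`priorDensity_mul_likelihood`): `σ₁^(-1-(n-a)) exp(-s₁₁/2σ₁²)`,
`τ^(-1-(n-b)) exp(-D/2τ²)`, a normal density for `θ` with mean `s₁₂/s₁₁` and variance `τ²/s₁₁`, and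
normal densities for the two means. The means integrate out, and the `σ₁` integral is a finite
constant because `a < n`. Under the substitution `v = D/τ²` the `τ` kernel becomes a chi-squared
density with `n-b` degrees of freedom. So the posterior of `θ` is the law of `c + dT`, where `c =
s₁₂/s₁₁`, `d² = D/s₁₁` and `T` has law `ratioLaw (n-b)`, that of `Z/√V`
(`posterior_proper_and_law`).

For the coverage, write `q` for the `(1-α)`-quantile of `ratioLaw (n-b)`. The credible bound is `c +
dq`, so coverage means `(θ - c)/d < q`. By `pivot_sampleOf` and Fisher's decomposition
(`map_regression_pi_gaussianReal`) this pivot has law `ratioLaw (n-2)`, whatever the parameters. The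
coverage is therefore the distribution function of `ratioLaw (n-2)` at `q`, which gives the Student
form after rescaling.

It equals `1-α` exactly when the distribution functions of `ratioLaw (n-2)` and `ratioLaw (n-b)`
agree at `q`. Both laws are symmetric, so they agree at `0`. For different degrees of freedom they
agree nowhere else (`measureReal_ratioLaw_Iio_eq_iff`), because two chi-squared densities cross once
and `v ↦ Φ(q√v)` is strictly monotone for `q > 0`. -/

theorem nullSingletonClass_map_affine {m : Measure ℝ} [NullSingletonClass m] (c : ℝ)
    {d : ℝ} (hd : 0 < d) :
    NullSingletonClass (m.map fun x => c + d * x) := by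
  refine ⟨fun y => ?_⟩
  rw [Measure.map_apply (by fun_prop) (measurableSet_singleton y)]
  refine measure_mono_null (t := {(y - c) / d}) (fun x hx => ?_) (measure_singleton _)
  simp only [mem_preimage, mem_singleton_iff] at hx ⊢
  rw [eq_div_iff hd.ne', ← hx]; ring

theorem isOpenPosMeasure_map_affine {m : Measure ℝ} [m.IsOpenPosMeasure] (c : ℝ)
    {d : ℝ} (hd : 0 < d) :
    (m.map fun x => c + d * x).IsOpenPosMeasure :=
  (show Continuous fun x : ℝ => c + d * x by fun_prop).isOpenPosMeasure_map fun y =>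
    ⟨(y - c) / d, by simp only; field_simp; ring⟩

theorem measureReal_map_affine_Iio {m : Measure ℝ} (c : ℝ) {d : ℝ} (hd : 0 < d) (q : ℝ) :
    (m.map fun x => c + d * x).real (Iio (c + d * q)) = m.real (Iio q) := by
  rw [map_measureReal_apply (by fun_prop) measurableSet_Iio]
  congr 1
  ext x
  simp [hd]

theorem measureReal_Iic_eq_Iio {m : Measure ℝ} [NullSingletonClass m]
    (q : ℝ) : m.real (Iic q) = m.real (Iio q) := by
  rw [measureReal_def, measureReal_def, measure_congr Iio_ae_eq_Iic]

theorem strictMono_measureReal_Iio {m : Measure ℝ} [IsProbabilityMeasure m]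
    [m.IsOpenPosMeasure] : StrictMono fun q => m.real (Iio q) := by
  intro a b hab
  have h : 0 < m.real (Ico a b) := by
    refine ENNReal.toReal_pos (fun h0 => ?_) (measure_ne_top _ _)
    exact (isOpen_Ioo.measure_pos m (nonempty_Ioo.2 hab)).ne'
      (measure_mono_null Ioo_subset_Ico_self h0)
  have h2 : m.real (Iio b) = m.real (Iio a) + m.real (Ico a b) := by
    rw [← Iio_union_Ico_eq_Iio hab.le, measureReal_union]
    · exact Set.disjoint_left.2 fun x hx hx' => not_le.2 hx hx'.1
    · exact measurableSet_Ico
  simp only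
  linarith

variable {m : Measure ℝ} [IsProbabilityMeasure m] [NullSingletonClass m]

/-- The mass of a point is the jump of the distribution function there. Continuity makes every level
in `(0, 1)` attained. -/
theorem continuous_cdf_of_nullSingletonClass : Continuous (cdf m) := by
  rw [continuous_iff_continuousAt]
  intro x
  rw [(monotone_cdf m).continuousAt_iff_leftLim_eq_rightLim, (cdf m).rightLim_eq]
  have h := (cdf m).measure_singleton x
  rw [measure_cdf, measure_singleton] at h
  have h' := ENNReal.ofReal_eq_zero.1 h.symm
  exact le_antisymm ((monotone_cdf m).leftLim_le le_rfl) (by linarith)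

theorem exists_measureReal_Iio_eq {u : ℝ} (hu : u ∈ Ioo (0 : ℝ) 1) :
    ∃ q, m.real (Iio q) = u := by
  obtain ⟨a, ha⟩ := ((tendsto_cdf_atBot m).eventually (gt_mem_nhds hu.1)).exists
  obtain ⟨b, hb⟩ := ((tendsto_cdf_atTop m).eventually (lt_mem_nhds hu.2)).exists
  obtain ⟨q, hq⟩ := mem_range_of_exists_le_of_exists_ge
    (continuous_cdf_of_nullSingletonClass (m := m)) ⟨a, ha.le⟩ ⟨b, hb.le⟩
  exact ⟨q, by rw [← measureReal_Iic_eq_Iio, ← cdf_eq_real, hq]⟩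

variable [m.IsOpenPosMeasure]

theorem quantile_eq_of_measureReal_Iio_eq {u q : ℝ} (h : m.real (Iio q) = u) :
    quantile m u = q := by
  have : {q' | u ≤ m.real (Iic q')} = Ici q := by
    ext q'
    rw [mem_ofPred_eq, measureReal_Iic_eq_Iio, ← h, mem_Ici]
    exact strictMono_measureReal_Iio.le_iff_le
  rw [quantile, this, csInf_Ici]

theorem measureReal_Iio_quantile {u : ℝ} (hu : u ∈ Ioo (0 : ℝ) 1) :
    m.real (Iio (quantile m u)) = u := by
  obtain ⟨q, hq⟩ := exists_measureReal_Iio_eq (m := m) hu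
  rw [quantile_eq_of_measureReal_Iio_eq hq, hq]

theorem measureReal_Iio_eq_iff {u : ℝ} (hu : u ∈ Ioo (0 : ℝ) 1) (q : ℝ) :
    m.real (Iio q) = u ↔ q = quantile m u :=
  ⟨fun h => (quantile_eq_of_measureReal_Iio_eq h).symm, fun h => h ▸ measureReal_Iio_quantile hu⟩

theorem quantile_map_affine (c : ℝ) {d : ℝ} (hd : 0 < d) {u : ℝ} (hu : u ∈ Ioo (0 : ℝ) 1) :
    quantile (m.map fun x => c + d * x) u = c + d * quantile m u := by
  have := nullSingletonClass_map_affine (m := m) c hd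
  have := isOpenPosMeasure_map_affine (m := m) c hd
  have : IsProbabilityMeasure (m.map fun x => c + d * x) :=
    Measure.isProbabilityMeasure_map (by fun_prop)
  apply quantile_eq_of_measureReal_Iio_eq
  rw [measureReal_map_affine_Iio c hd, measureReal_Iio_quantile hu]

end Quantile

/-! ### The ratio of a standard normal and the root of a chi-squared variable -/

theorem isProbabilityMeasure_chiSquared {ν : ℝ} (hν : 0 < ν) :
    IsProbabilityMeasure (chiSquared ν) :=
  isProbabilityMeasure_gammaMeasure (by positivity) (by norm_num)

theorem ae_chiSquared_pos (ν : ℝ) : ∀ᵐ v ∂chiSquared ν, 0 < v := by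
  have h : volume.withDensity (gammaPDF (ν / 2) (1 / 2)) (Iic 0) = 0 := by
    rw [withDensity_apply _ measurableSet_Iic, setLIntegral_congr Iio_ae_eq_Iic.symm]
    exact lintegral_gammaPDF_of_nonpos le_rfl
  filter_upwards [measure_eq_zero_iff_ae_notMem.1 h] with v hv
  simpa using hv

/-- The law of `Z / √V` with `Z` standard normal and `V` chi-squared with `ν` degrees of freedom,
independent. -/
noncomputable def ratioLaw (ν : ℝ) : Measure ℝ :=
  ((gaussianReal 0 1).prod (chiSquared ν)).map fun z => z.1 / √z.2

section RatioLaw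

variable {ν : ℝ}

theorem isProbabilityMeasure_ratioLaw (hν : 0 < ν) : IsProbabilityMeasure (ratioLaw ν) := by
  have := isProbabilityMeasure_chiSquared hν
  exact Measure.isProbabilityMeasure_map (by fun_prop)

theorem ratioLaw_apply (hν : 0 < ν) {s : Set ℝ} (hs : MeasurableSet s) :
    ratioLaw ν s = ∫⁻ v, gaussianReal 0 1 ((fun z => z / √v) ⁻¹' s) ∂chiSquared ν := by
  have := isProbabilityMeasure_chiSquared hν
  have hm : Measurable fun z : ℝ × ℝ => z.1 / √z.2 := by fun_prop
  rw [ratioLaw, Measure.map_apply hm hs, Measure.prod_apply_symm (hm hs)]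
  rfl

theorem nullSingletonClass_ratioLaw (hν : 0 < ν) : NullSingletonClass (ratioLaw ν) := by
  refine ⟨fun y => ?_⟩
  rw [ratioLaw_apply hν (measurableSet_singleton y), lintegral_eq_zero_iff']
  · filter_upwards [ae_chiSquared_pos ν] with v hv
    have := nullSingletonClass_gaussianReal (μ := 0) (v := 1) one_ne_zero
    refine measure_mono_null (t := {y * √v}) (fun x hx => ?_) (measure_singleton _)
    simp only [mem_preimage, mem_singleton_iff] at hx ⊢
    rw [← hx, div_mul_cancel₀ _ (Real.sqrt_pos.2 hv).ne']
  · have hm : Measurable fun z : ℝ × ℝ => z.1 / √z.2 := by fun_prop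
    exact (measurable_measure_prodMk_right (hm (measurableSet_singleton y))).aemeasurable

/-- If an open set were null, its preimage under `z ↦ z/√v` would be Gaussian-null for some `v > 0`.
That preimage is open and nonempty, and Lebesgue measure is absolutely continuous with respect to
the Gaussian. -/
theorem isOpenPosMeasure_ratioLaw (hν : 0 < ν) : (ratioLaw ν).IsOpenPosMeasure := by
  refine ⟨fun U hU hne h0 => ?_⟩
  have hm : Measurable fun z : ℝ × ℝ => z.1 / √z.2 := by fun_prop
  rw [ratioLaw_apply hν hU.measurableSet, lintegral_eq_zero_iff' (f := fun v =>
    gaussianReal 0 1 ((fun z => z / √v) ⁻¹' U))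
    (measurable_measure_prodMk_right (hm hU.measurableSet)).aemeasurable] at h0
  have := isProbabilityMeasure_chiSquared hν
  obtain ⟨v, hv, hpos⟩ := (h0.and (ae_chiSquared_pos ν)).exists
  have h1 := gaussianReal_absolutelyContinuous' 0 (v := 1) one_ne_zero hv
  have hc : Continuous fun z : ℝ => z / √v := by fun_prop
  obtain ⟨y, hy⟩ := hne
  refine ((hU.preimage hc).measure_pos volume ⟨y * √v, ?_⟩).ne' h1
  simpa [mul_div_cancel_right₀ _ (Real.sqrt_pos.2 hpos).ne'] using hy

theorem ratioLaw_map_neg (hν : 0 < ν) : (ratioLaw ν).map (fun x => -x) = ratioLaw ν := by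
  have := isProbabilityMeasure_chiSquared hν
  have h : ((gaussianReal 0 1).prod (chiSquared ν)).map (Prod.map (fun x => -x) id) =
      (gaussianReal 0 1).prod (chiSquared ν) := by
    rw [← Measure.map_prod_map _ _ (by fun_prop) (by fun_prop), Measure.map_id,
      gaussianReal_map_neg, neg_zero]
  conv_rhs => rw [ratioLaw, ← h]
  rw [ratioLaw, Measure.map_map (by fun_prop) (by fun_prop),
    Measure.map_map (by fun_prop) (by fun_prop)]
  congr 1
  ext z
  simp [neg_div]

theorem measureReal_ratioLaw_Iio_neg (hν : 0 < ν) (q : ℝ) :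
    (ratioLaw ν).real (Iio (-q)) = 1 - (ratioLaw ν).real (Iio q) := by
  have := isProbabilityMeasure_ratioLaw hν
  have := nullSingletonClass_ratioLaw hν
  conv_lhs => rw [← ratioLaw_map_neg hν]
  rw [map_measureReal_apply (by fun_prop) measurableSet_Iio, ← measureReal_Iic_eq_Iio,
    ← probReal_compl_eq_one_sub measurableSet_Iic]
  congr 1
  ext x
  simp

theorem measureReal_ratioLaw_Iio_zero (hν : 0 < ν) : (ratioLaw ν).real (Iio 0) = 1 / 2 := by
  have := measureReal_ratioLaw_Iio_neg hν 0
  rw [neg_zero] at this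
  linarith

/-- Stripping the scale `√ν` lets laws with different degrees of freedom be compared without
rescaling. The factor `√((n-2)/(n-b))` in the coverage formula comes only from this scale. -/
theorem studentT_eq_map_ratioLaw (hν : 0 < ν) :
    studentT ν = (ratioLaw ν).map fun x => 0 + √ν * x := by
  rw [studentT, ratioLaw, Measure.map_map (by fun_prop) (by fun_prop)]
  congr 1
  ext z
  simp only [Function.comp_apply, zero_add]
  rw [Real.sqrt_div' _ hν.le, div_div_eq_mul_div]
  ring

theorem map_const_sub_ratioLaw (hν : 0 < ν) (c d : ℝ) :
    (ratioLaw ν).map (fun x => c - x * d) = (ratioLaw ν).map fun x => c + d * x := by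
  conv_rhs => rw [← ratioLaw_map_neg hν]
  rw [Measure.map_map (by fun_prop) (by fun_prop)]
  congr 1
  ext x
  simp only [Function.comp_apply]
  ring

/-- The distribution function of `Z / √V`, by conditioning on `V`. -/
theorem measureReal_ratioLaw_Iio (hν : 0 < ν) (q : ℝ) :
    (ratioLaw ν).real (Iio q) =
      ∫ v, (gaussianReal 0 1).real (Iio (q * √v)) * gammaPDFReal (ν / 2) (1 / 2) v := by
  have := isProbabilityMeasure_chiSquared hν
  have hm : Measurable fun v : ℝ => gaussianReal 0 1 (Iio (q * √v)) :=
    (Monotone.measurable fun a b hab => measure_mono (Iio_subset_Iio hab)).comp (by fun_prop)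
  have h : ratioLaw ν (Iio q) = ∫⁻ v, gaussianReal 0 1 (Iio (q * √v)) ∂chiSquared ν := by
    rw [ratioLaw_apply hν measurableSet_Iio]
    refine lintegral_congr_ae ?_
    filter_upwards [ae_chiSquared_pos ν] with v hv
    congr 1
    ext z
    simp [div_lt_iff₀ (Real.sqrt_pos.2 hv)]
  rw [measureReal_def, h, chiSquared, gammaMeasure, lintegral_withDensity_eq_lintegral_mul _
    (by unfold gammaPDF; fun_prop) hm, ← integral_toReal]
  · refine integral_congr_ae (ae_of_all _ fun v => ?_)
    simp only [Pi.mul_apply, ENNReal.toReal_mul, gammaPDF]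
    rw [ENNReal.toReal_ofReal (gammaPDFReal_nonneg (by positivity) (by norm_num) v), mul_comm]
    rfl
  · exact (Measurable.mul (by unfold gammaPDF; fun_prop) hm).aemeasurable
  · exact ae_of_all _ fun v => ENNReal.mul_lt_top ENNReal.ofReal_lt_top (measure_lt_top _ _)

theorem integral_gammaPDFReal_half (hν : 0 < ν) :
    Integrable (gammaPDFReal (ν / 2) (1 / 2)) ∧ ∫ v, gammaPDFReal (ν / 2) (1 / 2) v = 1 := by
  have h0 : 0 ≤ᵐ[volume] gammaPDFReal (ν / 2) (1 / 2) :=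
    ae_of_all _ fun v => gammaPDFReal_nonneg (by positivity) (by norm_num) v
  have h1 := lintegral_gammaPDF_eq_one (a := ν / 2) (r := 1 / 2) (by positivity) (by norm_num)
  refine ⟨⟨by fun_prop, ?_⟩, ?_⟩
  · rw [hasFiniteIntegral_iff_ofReal h0]
    exact h1.trans_lt ENNReal.one_lt_top
  · rw [integral_eq_lintegral_of_nonneg_ae h0 (by fun_prop)]
    exact (congrArg _ h1).trans ENNReal.toReal_one

theorem strictMono_measureReal_gaussianReal_Iio :
    StrictMono fun q => (gaussianReal 0 1).real (Iio q) := by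
  have := nullSingletonClass_gaussianReal (μ := 0) (v := 1) one_ne_zero
  have : (gaussianReal 0 1).IsOpenPosMeasure :=
    (gaussianReal_absolutelyContinuous' 0 (v := 1) one_ne_zero).isOpenPosMeasure
  exact strictMono_measureReal_Iio

/-- The densities of two chi-squared distributions cross exactly once. -/
theorem exists_gammaPDFReal_crossing {ν' : ℝ} (hν : 0 < ν) (h : ν < ν') :
    ∃ v₀ > 0, (∀ v ∈ Ioo 0 v₀, gammaPDFReal (ν' / 2) (1 / 2) v < gammaPDFReal (ν / 2) (1 / 2) v) ∧
      ∀ v ∈ Ioi v₀, gammaPDFReal (ν / 2) (1 / 2) v < gammaPDFReal (ν' / 2) (1 / 2) v := by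
  have hν' : 0 < ν' := hν.trans h
  set k : ℝ → ℝ := fun μ => (1 / 2 : ℝ) ^ (μ / 2) / Real.Gamma (μ / 2) with hk
  have hkpos : ∀ μ, 0 < μ → 0 < k μ := fun μ hμ =>
    div_pos (by positivity) (Real.Gamma_pos_of_pos (by positivity))
  set e : ℝ := (ν' - ν) / 2 with he
  have hepos : 0 < e := by rw [he]; linarith
  have hpdf : ∀ μ v, 0 < v → gammaPDFReal (μ / 2) (1 / 2) v =
      k μ * v ^ (μ / 2 - 1) * Real.exp (-(1 / 2 * v)) := by
    intro μ v hv
    simp [gammaPDFReal, hv.le, hk]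
  have hsplit : ∀ v, 0 < v → gammaPDFReal (ν' / 2) (1 / 2) v =
      (k ν' / k ν * v ^ e) * gammaPDFReal (ν / 2) (1 / 2) v := by
    intro v hv
    rw [hpdf _ _ hv, hpdf _ _ hv, show ν' / 2 - 1 = e + (ν / 2 - 1) by rw [he]; ring,
      Real.rpow_add hv]
    have := (hkpos ν hν).ne'
    field_simp
  have hK : 0 < k ν' / k ν := div_pos (hkpos _ hν') (hkpos _ hν)
  -- The quotient of the densities is `K v^e` with `K = k ν' / k ν` and `e > 0`. It is increasing,
  -- and the witness solves `K v^e = 1`.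
  refine ⟨(k ν' / k ν)⁻¹ ^ e⁻¹, by positivity, fun v hv => ?_, fun v hv => ?_⟩
  · rw [hsplit v hv.1]
    have h1 : v ^ e < (k ν' / k ν)⁻¹ := by
      exact (Real.lt_rpow_inv_iff_of_pos hv.1.le (by positivity) hepos).1 hv.2
    have h2 : k ν' / k ν * v ^ e < 1 := by
      have hv1 := hv.1
      rwa [lt_inv_comm₀ (by positivity) hK, lt_inv_comm₀ hK (by positivity), ← one_div,
        lt_div_iff₀ hK, mul_comm] at h1
    have h3 := gammaPDFReal_pos (a := ν / 2) (r := 1 / 2) (by positivity) (by norm_num) hv.1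
    nlinarith
  · have hv0 : 0 < v := lt_trans (by positivity) hv
    rw [hsplit v hv0]
    have h1 : (k ν' / k ν)⁻¹ < v ^ e :=
      (Real.rpow_inv_lt_iff_of_pos (by positivity) hv0.le hepos).1 hv
    have h2 : 1 < k ν' / k ν * v ^ e := by
      rwa [← one_div, div_lt_iff₀ hK, mul_comm] at h1
    have h3 := gammaPDFReal_pos (a := ν / 2) (r := 1 / 2) (by positivity) (by norm_num) hv0
    nlinarith

/-- With `g v = Φ(q√v)`, the difference of the two probabilities is the integral of `g (f' - f)`.
Subtracting the constant `g v₀`, where `v₀` is the crossing point of the densities, makes the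
integrand a product of two factors that change sign together, hence positive on `(0, ∞)` except at
`v₀`. -/
theorem measureReal_ratioLaw_Iio_ne_of_lt {ν' : ℝ} (hν : 0 < ν) (h : ν < ν') {q : ℝ} (hq : 0 < q) :
    (ratioLaw ν).real (Iio q) ≠ (ratioLaw ν').real (Iio q) := by
  have hν' : 0 < ν' := hν.trans h
  intro heq
  obtain ⟨v₀, hv₀, hlt, hgt⟩ := exists_gammaPDFReal_crossing hν h
  set g : ℝ → ℝ := fun v => (gaussianReal 0 1).real (Iio (q * √v)) with hg
  set f := gammaPDFReal (ν / 2) (1 / 2)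
  set f' := gammaPDFReal (ν' / 2) (1 / 2)
  have hgm : Measurable g :=
    strictMono_measureReal_gaussianReal_Iio.monotone.measurable.comp (by fun_prop)
  obtain ⟨hf, hf1⟩ := integral_gammaPDFReal_half hν
  obtain ⟨hf', hf'1⟩ := integral_gammaPDFReal_half hν'
  have hbd : ∀ᵐ v ∂volume, ‖g v‖ ≤ 1 := ae_of_all _ fun v => by
    rw [Real.norm_of_nonneg measureReal_nonneg]
    exact measureReal_le_one
  have hgf : Integrable fun v => g v * f v := hf.bdd_mul hgm.aestronglyMeasurable hbd
  have hgf' : Integrable fun v => g v * f' v := hf'.bdd_mul hgm.aestronglyMeasurable hbd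
  have hint : Integrable fun v => (g v - g v₀) * (f' v - f v) := by
    refine ((hgf'.sub hgf).sub ((hf'.sub hf).const_mul (g v₀))).congr (ae_of_all _ fun v => ?_)
    simp only [Pi.sub_apply]
    ring
  -- The constant `g v₀` contributes nothing, since both densities have integral one.
  have h0 : ∫ v, (g v - g v₀) * (f' v - f v) = 0 := by
    calc ∫ v, (g v - g v₀) * (f' v - f v)
        = ∫ v, ((g v * f' v - g v * f v) - g v₀ * (f' v - f v)) := by
          congr 1; ext v; ring
      _ = (∫ v, g v * f' v) - (∫ v, g v * f v) - g v₀ * ((∫ v, f' v) - ∫ v, f v) := by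
          rw [integral_sub, integral_sub hgf' hgf, integral_const_mul, integral_sub hf' hf]
          · exact hgf'.sub hgf
          · exact (hf'.sub hf).const_mul (g v₀)
      _ = 0 := by
          rw [← measureReal_ratioLaw_Iio hν, ← measureReal_ratioLaw_Iio hν', heq, hf1, hf'1]
          ring
  have hpos : ∀ v, 0 < v → v ≠ v₀ → 0 < (g v - g v₀) * (f' v - f v) := by
    intro v hv hne
    rcases lt_or_gt_of_ne hne with hl | hl
    · have : g v < g v₀ := strictMono_measureReal_gaussianReal_Iio
        (mul_lt_mul_of_pos_left (Real.sqrt_lt_sqrt hv.le hl) hq)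
      have := hlt v ⟨hv, hl⟩
      exact mul_pos_of_neg_of_neg (by linarith) (by linarith)
    · have : g v₀ < g v := strictMono_measureReal_gaussianReal_Iio
        (mul_lt_mul_of_pos_left (Real.sqrt_lt_sqrt hv₀.le hl) hq)
      have := hgt v hl
      exact mul_pos (by linarith) (by linarith)
  have hnn : 0 ≤ᵐ[volume] fun v => (g v - g v₀) * (f' v - f v) := by
    -- The point `0` is discarded: `gammaPDFReal` vanishes only for negative arguments, so its value
    -- at `0` depends on the convention for `0 ^ y`.
    filter_upwards [compl_mem_ae_iff.2 (measure_singleton (0 : ℝ))] with v hv0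
    rcases lt_or_gt_of_ne (hv0 : v ≠ 0) with hv | hv
    · simp [f, f', gammaPDFReal, not_le.2 hv]
    · rcases eq_or_ne v v₀ with rfl | hne
      · simp
      · exact (hpos v hv hne).le
  rw [integral_eq_zero_iff_of_nonneg_ae hnn hint] at h0
  have hz : volume (Ioo 0 v₀) = 0 :=
    measure_mono_null (fun v hv => (hpos v hv.1 hv.2.ne).ne') h0
  rw [Real.volume_Ioo, ENNReal.ofReal_eq_zero] at hz
  linarith

/-- Away from the median, the value of the distribution function determines the degrees of
freedom. -/
theorem measureReal_ratioLaw_Iio_eq_iff {ν' : ℝ} (hν : 0 < ν) (hν' : 0 < ν') (q : ℝ) :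
    (ratioLaw ν).real (Iio q) = (ratioLaw ν').real (Iio q) ↔ ν = ν' ∨ q = 0 := by
  have hpos : ∀ q : ℝ, 0 < q → (ratioLaw ν).real (Iio q) = (ratioLaw ν').real (Iio q) →
      ν = ν' := by
    intro q hq h
    rcases lt_trichotomy ν ν' with hl | hl | hl
    · exact absurd h (measureReal_ratioLaw_Iio_ne_of_lt hν hl hq)
    · exact hl
    · exact absurd h.symm (measureReal_ratioLaw_Iio_ne_of_lt hν' hl hq)
  refine ⟨fun h => ?_, ?_⟩
  · rcases lt_trichotomy q 0 with hq | hq | hq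
    · refine Or.inl (hpos (-q) (by linarith) ?_)
      rw [measureReal_ratioLaw_Iio_neg hν, measureReal_ratioLaw_Iio_neg hν', h]
    · exact Or.inr hq
    · exact Or.inl (hpos q hq h)
  · rintro (rfl | rfl)
    · rfl
    · rw [measureReal_ratioLaw_Iio_zero hν, measureReal_ratioLaw_Iio_zero hν']

end RatioLaw

/-! ### The likelihood in regression coordinates -/

section Likelihood

variable {n : ℕ}

theorem sum_sub_sampleMean (hn : 0 < n) (x : Sample n) (i : Fin 2) :
    ∑ k, (x k i - sampleMean x i) = 0 := by
  have : (n : ℝ) ≠ 0 := by positivity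
  rw [Finset.sum_sub_distrib, Finset.sum_const, Finset.card_univ, Fintype.card_fin, nsmul_eq_mul,
    sampleMean, mul_inv_cancel_left₀ this, sub_self]

/-- The terms linear in `γ` drop out because deviations from the mean sum to zero. One identity
serves both the sum of squares of the first coordinate and that of the regression residuals. -/
theorem sum_sq_affine (hn : 0 < n) (x : Sample n) (α β γ : ℝ) :
    ∑ k, (α * (x k 0 - sampleMean x 0) + β * (x k 1 - sampleMean x 1) + γ) ^ 2 =
      α ^ 2 * scatter x 0 0 + 2 * α * β * scatter x 0 1 + β ^ 2 * scatter x 1 1 + n * γ ^ 2 := by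
  have h : ∀ k, (α * (x k 0 - sampleMean x 0) + β * (x k 1 - sampleMean x 1) + γ) ^ 2 =
      α ^ 2 * ((x k 0 - sampleMean x 0) * (x k 0 - sampleMean x 0)) +
      2 * α * β * ((x k 0 - sampleMean x 0) * (x k 1 - sampleMean x 1)) +
      β ^ 2 * ((x k 1 - sampleMean x 1) * (x k 1 - sampleMean x 1)) +
      2 * α * γ * (x k 0 - sampleMean x 0) + 2 * β * γ * (x k 1 - sampleMean x 1) + γ ^ 2 := by
    intro k; ring
  simp only [h, Finset.sum_add_distrib, ← Finset.mul_sum, sum_sub_sampleMean hn]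
  simp [scatter]

/-- This is the factorization into the marginal of the first coordinate and the conditional of the
second, whose regression slope is `ρt/s` and standard deviation `tw`. -/
theorem log_kernel_eq {s t w ρ μ₁ μ₂ x₀ x₁ : ℝ} (hs : 0 < s) (ht : 0 < t) (hw : 0 < w)
    (hρ : 1 - ρ ^ 2 = w ^ 2) :
    -(1 / (2 * (1 - ρ ^ 2))) * (((x₀ - μ₁) / s) ^ 2 - 2 * ρ * ((x₀ - μ₁) / s) * ((x₁ - μ₂) / t)
      + ((x₁ - μ₂) / t) ^ 2) =
    -(1 / (2 * s ^ 2)) * (x₀ - μ₁) ^ 2 -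
      1 / (2 * (t * w) ^ 2) * (x₁ - μ₂ - ρ * t / s * (x₀ - μ₁)) ^ 2 := by
  have h : ρ ^ 2 = 1 - w ^ 2 := by linarith
  rw [hρ]
  field_simp
  ring_nf
  rw [h]
  ring

theorem likelihood_eq (hn : 0 < n) (x : Sample n) {μ₁ μ₂ s t ρ w : ℝ} (hs : 0 < s) (ht : 0 < t)
    (hw : 0 < w) (hρ : 1 - ρ ^ 2 = w ^ 2) (h11 : 0 < scatter x 0 0) :
    likelihood x (μ₁, μ₂, s, t, ρ) = (2 * Real.pi * s * t * w)⁻¹ ^ n *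
      Real.exp (-(scatter x 0 0 / (2 * s ^ 2))) *
      Real.exp (-((scatter x 1 1 - scatter x 0 1 ^ 2 / scatter x 0 0) / (2 * (t * w) ^ 2))) *
      Real.exp (-(scatter x 0 0 * (ρ * t / s - scatter x 0 1 / scatter x 0 0) ^ 2 /
        (2 * (t * w) ^ 2))) *
      Real.exp (-(n * (μ₁ - sampleMean x 0) ^ 2 / (2 * s ^ 2))) *
      Real.exp (-(n * (μ₂ - (sampleMean x 1 + ρ * t / s * (μ₁ - sampleMean x 0))) ^ 2 /
        (2 * (t * w) ^ 2))) := by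
  have h1 := sum_sq_affine hn x 1 0 (sampleMean x 0 - μ₁)
  have h2 := sum_sq_affine hn x (-(ρ * t / s)) 1
    (sampleMean x 1 - μ₂ - ρ * t / s * (sampleMean x 0 - μ₁))
  have e1 : ∀ k, (1 * (x k 0 - sampleMean x 0) + 0 * (x k 1 - sampleMean x 1) +
      (sampleMean x 0 - μ₁)) ^ 2 = (x k 0 - μ₁) ^ 2 := fun k => by ring
  have e2 : ∀ k, (-(ρ * t / s) * (x k 0 - sampleMean x 0) + 1 * (x k 1 - sampleMean x 1) +
      (sampleMean x 1 - μ₂ - ρ * t / s * (sampleMean x 0 - μ₁))) ^ 2 =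
      (x k 1 - μ₂ - ρ * t / s * (x k 0 - μ₁)) ^ 2 := fun k => by ring
  simp only [e1, e2] at h1 h2
  have hsqrt : √(1 - ρ ^ 2) = w := by rw [hρ, Real.sqrt_sq hw.le]
  simp only [likelihood, normalDensity, hsqrt, log_kernel_eq hs ht hw hρ]
  rw [Finset.prod_mul_distrib, Finset.prod_const, Finset.card_univ, Fintype.card_fin,
    ← Real.exp_sum, Finset.sum_sub_distrib, ← Finset.mul_sum, ← Finset.mul_sum, h1, h2, one_div]
  simp only [mul_assoc ((2 * Real.pi * s * t * w)⁻¹ ^ n), ← Real.exp_add]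
  congr 2
  field_simp
  ring

theorem gaussianPDFReal_toNNReal {m N y : ℝ} (hN : 0 < N) (hy : 0 < y) (z : ℝ) :
    gaussianPDFReal m (y ^ 2 / N).toNNReal z =
      (√(2 * Real.pi / N))⁻¹ * y⁻¹ * Real.exp (-(N * (z - m) ^ 2 / (2 * y ^ 2))) := by
  rw [gaussianPDFReal, Real.coe_toNNReal _ (by positivity), ← mul_inv]
  congr 2
  · rw [← mul_div_assoc, ← div_mul_eq_mul_div, Real.sqrt_mul (by positivity), Real.sqrt_sq hy.le]
  · field_simp

/-- The normalizing constant of the posterior density in regression coordinates. -/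
noncomputable def regressionConst (n : ℕ) (s₁₁ : ℝ) : ℝ :=
  (2 * Real.pi)⁻¹ ^ n * √(2 * Real.pi / s₁₁) * √(2 * Real.pi / n) ^ 2

/-- The leading factor is the Jacobian of `(t, ρ) ↦ (t√(1-ρ²), ρt/s)`. Once it is set aside, what
remains depends on `t` and `ρ` only through those two coordinates. -/
theorem priorDensity_mul_likelihood (hn : 0 < n) (a b : ℝ) (x : Sample n) {μ₁ μ₂ s t ρ : ℝ}
    (hs : 0 < s) (ht : 0 < t) (hρ : -1 < ρ ∧ ρ < 1) (h11 : 0 < scatter x 0 0) :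
    priorDensity a b (μ₁, μ₂, s, t, ρ) * likelihood x (μ₁, μ₂, s, t, ρ) =
      t / (s * √(1 - ρ ^ 2)) * (regressionConst n (scatter x 0 0) *
        (s ^ (-1 - (n - a)) * Real.exp (-(scatter x 0 0 / (2 * s ^ 2)))) *
        ((t * √(1 - ρ ^ 2)) ^ (-1 - (n - b)) *
          Real.exp (-((scatter x 1 1 - scatter x 0 1 ^ 2 / scatter x 0 0) /
            (2 * (t * √(1 - ρ ^ 2)) ^ 2)))) *
        gaussianPDFReal (scatter x 0 1 / scatter x 0 0)
          ((t * √(1 - ρ ^ 2)) ^ 2 / scatter x 0 0).toNNReal (ρ * t / s) *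
        gaussianPDFReal (sampleMean x 0) (s ^ 2 / n).toNNReal μ₁ *
        gaussianPDFReal (sampleMean x 1 + ρ * t / s * (μ₁ - sampleMean x 0))
          ((t * √(1 - ρ ^ 2)) ^ 2 / n).toNNReal μ₂) := by
  have hpos : 0 < 1 - ρ ^ 2 := by nlinarith [hρ.1, hρ.2]
  have hw := Real.sqrt_pos.2 hpos
  have hw2 : 1 - ρ ^ 2 = √(1 - ρ ^ 2) ^ 2 := (Real.sq_sqrt hpos.le).symm
  have hn' : (0 : ℝ) < n := by positivity
  rw [likelihood_eq hn x hs ht hw hw2 h11, gaussianPDFReal_toNNReal h11 (by positivity),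
    gaussianPDFReal_toNNReal hn' hs, gaussianPDFReal_toNNReal hn' (by positivity), priorDensity,
    regressionConst]
  simp only
  set E1 := Real.exp (-(scatter x 0 0 / (2 * s ^ 2)))
  set w := √(1 - ρ ^ 2) with hwdef
  rw [hw2]
  set E2 := Real.exp (-((scatter x 1 1 - scatter x 0 1 ^ 2 / scatter x 0 0) / (2 * (t * w) ^ 2)))
  set E3 := Real.exp (-(scatter x 0 0 * (ρ * t / s - scatter x 0 1 / scatter x 0 0) ^ 2 /
        (2 * (t * w) ^ 2)))
  set E4 := Real.exp (-(n * (μ₁ - sampleMean x 0) ^ 2 / (2 * s ^ 2)))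
  set E5 := Real.exp (-(n * (μ₂ - (sampleMean x 1 + ρ * t / s * (μ₁ - sampleMean x 0))) ^ 2 /
        (2 * (t * w) ^ 2)))
  have hA : √(2 * Real.pi / scatter x 0 0) ≠ 0 := by positivity
  have hB : √(2 * Real.pi / n) ≠ 0 := by positivity
  -- The last three factors are the inverse scales in the normalizations of the three Gaussian
  -- densities. Writing `s`, `t`, `w` as exponentials turns the bookkeeping of real powers into a
  -- linear identity of exponents.
  have key : 1 / (s ^ (3 - a) * t ^ (2 - b) * (w ^ 2) ^ (2 - b / 2)) * (s * t * w)⁻¹ ^ n =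
      t / (s * w) * s ^ (-1 - (n - a)) * (t * w) ^ (-1 - (n - b)) * (t * w)⁻¹ * s⁻¹ *
        (t * w)⁻¹ := by
    obtain ⟨A, rfl⟩ : ∃ A, s = Real.exp A := ⟨Real.log s, (Real.exp_log hs).symm⟩
    obtain ⟨B, rfl⟩ : ∃ A, t = Real.exp A := ⟨Real.log t, (Real.exp_log ht).symm⟩
    obtain ⟨C, hC⟩ : ∃ A, w = Real.exp A := ⟨Real.log w, (Real.exp_log hw).symm⟩
    rw [hC]
    simp only [← Real.exp_add, ← Real.exp_mul, ← Real.exp_neg, ← Real.exp_nat_mul,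
      div_eq_mul_inv, one_mul]
    congr 1
    push_cast
    ring
  have hsplit : (2 * Real.pi * s * t * w)⁻¹ ^ n = (2 * Real.pi)⁻¹ ^ n * (s * t * w)⁻¹ ^ n := by
    rw [← mul_pow, ← mul_inv]; ring_nf
  rw [hsplit]
  calc _ = (2 * Real.pi)⁻¹ ^ n * E1 * E2 * E3 * E4 * E5 *
        (1 / (s ^ (3 - a) * t ^ (2 - b) * (w ^ 2) ^ (2 - b / 2)) * (s * t * w)⁻¹ ^ n) := by ring
    _ = _ := by
      rw [key]
      field_simp

end Likelihood

/-! ### Changes of variables -/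

theorem hasFDerivAt_regressionCoords (s : ℝ) {z : ℝ × ℝ} (hz : 0 < 1 - z.2 ^ 2) :
    HasFDerivAt (fun z : ℝ × ℝ => (z.1 * √(1 - z.2 ^ 2), z.2 * z.1 / s))
      (LinearMap.toContinuousLinearMap (Matrix.toLin (Module.Basis.finTwoProd ℝ)
        (Module.Basis.finTwoProd ℝ)
        !![√(1 - z.2 ^ 2), -(z.1 * z.2 / √(1 - z.2 ^ 2)); z.2 / s, z.1 / s])) z := by
  rw [Matrix.toLin_finTwoProd_toContinuousLinearMap]
  have h1 : HasDerivAt (fun y : ℝ => √(1 - y ^ 2)) (-(z.2 / √(1 - z.2 ^ 2))) z.2 := by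
    have h : HasDerivAt (fun y : ℝ => 1 - y ^ 2) (-(2 * z.2)) z.2 :=
      ((hasDerivAt_pow 2 z.2).const_sub 1).congr_deriv (by norm_num)
    refine (h.sqrt hz.ne').congr_deriv ?_
    have := Real.sqrt_pos.2 hz
    field_simp
  have h2 : HasFDerivAt (fun z : ℝ × ℝ => √(1 - z.2 ^ 2)) _ z :=
    h1.comp_hasFDerivAt z (hasFDerivAt_snd (𝕜 := ℝ) (E := ℝ) (F := ℝ) (p := z))
  have h3 : HasFDerivAt (fun z : ℝ × ℝ => z.2 * z.1 / s) _ z :=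
    ((hasFDerivAt_snd (𝕜 := ℝ) (E := ℝ) (F := ℝ) (p := z)).mul
      (hasFDerivAt_fst (𝕜 := ℝ) (E := ℝ) (F := ℝ) (p := z))).mul_const s⁻¹
  refine ((hasFDerivAt_fst.mul h2).prodMk h3).congr_fderiv ?_
  ext <;> simp <;> ring

theorem det_regressionCoords (s : ℝ) {z : ℝ × ℝ} (hz : 0 < 1 - z.2 ^ 2) :
    (LinearMap.toContinuousLinearMap (Matrix.toLin (Module.Basis.finTwoProd ℝ)
        (Module.Basis.finTwoProd ℝ)
        !![√(1 - z.2 ^ 2), -(z.1 * z.2 / √(1 - z.2 ^ 2)); z.2 / s, z.1 / s])).det =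
      z.1 / (s * √(1 - z.2 ^ 2)) := by
  have h := Real.sqrt_pos.2 hz
  have h2 := Real.sq_sqrt hz.le
  rw [LinearMap.det_toContinuousLinearMap, LinearMap.det_toLin, Matrix.det_fin_two_of]
  rcases eq_or_ne s 0 with rfl | hs
  · simp
  field_simp
  rw [h2]
  ring

/-- For fixed `s` the map `(t, ρ) ↦ (τ, θ)` is a bijection of the half-strip onto the half-plane:
`t² = τ² + (θs)²` recovers `t`, and then `ρ = θs/t`. -/
theorem lintegral_regressionCoords {s : ℝ} (hs : 0 < s) (F : ℝ × ℝ → ℝ≥0∞) :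
    ∫⁻ z in Ioi 0 ×ˢ univ, F z = ∫⁻ z in Ioi 0 ×ˢ Ioo (-1) 1,
      ENNReal.ofReal (z.1 / (s * √(1 - z.2 ^ 2))) * F (z.1 * √(1 - z.2 ^ 2), z.2 * z.1 / s) := by
  have hpos : ∀ z ∈ (Ioi 0 ×ˢ Ioo (-1) 1 : Set (ℝ × ℝ)), 0 < 1 - z.2 ^ 2 := by
    rintro z ⟨-, h1, h2⟩
    nlinarith
  have himg : (fun z : ℝ × ℝ => (z.1 * √(1 - z.2 ^ 2), z.2 * z.1 / s)) ''
      (Ioi 0 ×ˢ Ioo (-1) 1) = Ioi 0 ×ˢ univ := by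
    ext ⟨τ, θ⟩
    simp only [mem_image, mem_prod, mem_Ioi, mem_univ, and_true, Prod.mk.injEq]
    constructor
    · rintro ⟨z, hz, rfl, -⟩
      exact mul_pos hz.1 (Real.sqrt_pos.2 (hpos z hz))
    · intro hτ
      have hq : 0 < τ ^ 2 + (θ * s) ^ 2 := by positivity
      have ht := Real.sqrt_pos.2 hq
      have ht2 := Real.sq_sqrt hq.le
      set t := √(τ ^ 2 + (θ * s) ^ 2)
      have h1 : 1 - (θ * s / t) ^ 2 = (τ / t) ^ 2 := by
        field_simp
        linarith
      refine ⟨(t, θ * s / t), ⟨ht, abs_lt.1 ((sq_lt_one_iff_abs_lt_one _).1 ?_)⟩, ?_, ?_⟩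
      · have : 0 < (τ / t) ^ 2 := by positivity
        linarith
      · simp only
        rw [h1, Real.sqrt_sq (by positivity)]
        field_simp
      · simp only
        field_simp
  have hinj : InjOn (fun z : ℝ × ℝ => (z.1 * √(1 - z.2 ^ 2), z.2 * z.1 / s))
      (Ioi 0 ×ˢ Ioo (-1) 1) := by
    intro z hz y hy h
    simp only [Prod.mk.injEq] at h
    have hz1 : 0 < z.1 := hz.1
    have hy1 : 0 < y.1 := hy.1
    have h2 : z.2 * z.1 = y.2 * y.1 := by
      have := h.2
      field_simp at this
      linarith
    have h1 : z.1 ^ 2 * (1 - z.2 ^ 2) = y.1 ^ 2 * (1 - y.2 ^ 2) := by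
      have := congrArg (· ^ 2) h.1
      simpa only [mul_pow, Real.sq_sqrt (hpos z hz).le, Real.sq_sqrt (hpos y hy).le] using this
    have h3 : z.1 ^ 2 = y.1 ^ 2 := by
      have := congrArg (· ^ 2) h2
      simp only [mul_pow] at this
      linarith
    have h4 : z.1 = y.1 := (sq_eq_sq₀ hz1.le hy1.le).1 h3
    rw [h4] at h2
    exact Prod.ext h4 (mul_right_cancel₀ hy1.ne' h2)
  rw [← himg, lintegral_image_eq_lintegral_abs_det_fderiv_mul volume
    (measurableSet_Ioi.prod measurableSet_Ioo)
    (fun z hz => (hasFDerivAt_regressionCoords s (hpos z hz)).hasFDerivWithinAt) hinj]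
  refine setLIntegral_congr_fun (measurableSet_Ioi.prod measurableSet_Ioo) fun z hz => ?_
  have : 0 < z.1 := hz.1
  rw [det_regressionCoords s (hpos z hz), abs_of_nonneg (by positivity)]

/-- This is the substitution `v = D/τ²`. Only positivity of the constant and its independence of `g`
matter later, since the posterior is normalized anyway. -/
theorem lintegral_chiSquared_eq {ν D : ℝ} (hν : 0 < ν) (hD : 0 < D) :
    ∃ k : ℝ, 0 < k ∧ ∀ g : ℝ → ℝ≥0∞, Measurable g → ∫⁻ v, g v ∂chiSquared ν =
      ∫⁻ τ in Ioi 0, ENNReal.ofReal (k * (τ ^ (-1 - ν) * Real.exp (-(D / (2 * τ ^ 2))))) *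
        g (D / τ ^ 2) := by
  set c := (1 / 2 : ℝ) ^ (ν / 2) / Real.Gamma (ν / 2)
  have hc : 0 < c := div_pos (by positivity) (Real.Gamma_pos_of_pos (by positivity))
  -- The density contributes `D^(ν/2 - 1)` and the derivative `2D/τ³` the rest.
  refine ⟨c * 2 * D ^ (ν / 2), by positivity, fun g hg => ?_⟩
  have himg : (fun τ : ℝ => D / τ ^ 2) '' Ioi 0 = Ioi 0 := by
    ext v
    simp only [mem_image, mem_Ioi]
    constructor
    · rintro ⟨τ, hτ, rfl⟩; positivity
    · intro hv
      refine ⟨√(D / v), by positivity, ?_⟩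
      rw [Real.sq_sqrt (by positivity)]
      field_simp
  have hanti : AntitoneOn (fun τ : ℝ => D / τ ^ 2) (Ioi 0) := by
    intro y hy z hz hyz
    have : 0 < y := hy
    simp only
    gcongr
  have hder : ∀ τ ∈ Ioi (0 : ℝ), HasDerivWithinAt (fun τ : ℝ => D / τ ^ 2)
      (-(2 * D / τ ^ 3)) (Ioi 0) τ := by
    intro τ hτ
    have hτ' : 0 < τ := hτ
    have h := ((hasDerivAt_pow 2 τ).inv (by positivity)).const_mul D
    refine (h.congr_deriv ?_).hasDerivWithinAt
    norm_num
    field_simp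
  have h1 : ∫⁻ v, g v ∂chiSquared ν = ∫⁻ v in Ioi 0, gammaPDF (ν / 2) (1 / 2) v * g v := by
    have h2 : ∫⁻ v, g v ∂chiSquared ν = ∫⁻ v in Ioi 0, g v ∂chiSquared ν := by
      rw [Measure.restrict_eq_self_of_ae_mem (s := Ioi 0) (ae_chiSquared_pos ν)]
    rw [h2, chiSquared, gammaMeasure, restrict_withDensity measurableSet_Ioi,
      lintegral_withDensity_eq_lintegral_mul _ (by unfold gammaPDF; fun_prop) hg]
    rfl
  rw [h1, ← himg, lintegral_image_eq_lintegral_deriv_mul_of_antitoneOn measurableSet_Ioi hder hanti,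
    himg]
  refine setLIntegral_congr_fun measurableSet_Ioi fun τ hτ => ?_
  have hτ' : 0 < τ := hτ
  rw [← mul_assoc, gammaPDF, ← ENNReal.ofReal_mul (by simp only [neg_neg]; positivity)]
  congr 2
  rw [gammaPDFReal, if_pos (by positivity)]
  have hE : Real.exp (-(1 / 2 * (D / τ ^ 2))) = Real.exp (-(D / (2 * τ ^ 2))) := by
    congr 1; field_simp
  rw [hE]
  have key : 2 * D / τ ^ 3 * (D / τ ^ 2) ^ (ν / 2 - 1) = 2 * D ^ (ν / 2) * τ ^ (-1 - ν) := by
    obtain ⟨A, rfl⟩ : ∃ A, τ = Real.exp A := ⟨Real.log τ, (Real.exp_log hτ').symm⟩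
    obtain ⟨B, rfl⟩ : ∃ A, D = Real.exp A := ⟨Real.log D, (Real.exp_log hD).symm⟩
    simp only [mul_assoc, ← Real.exp_add, ← Real.exp_mul, ← Real.exp_neg,
      ← Real.exp_nat_mul, div_eq_mul_inv]
    congr 2
    push_cast
    ring
  linear_combination c * Real.exp (-(D / (2 * τ ^ 2))) * key

/-! ### The posterior distribution of the regression coefficient -/

section Posterior

theorem restrict_paramSpace : (volume : Measure Param).restrict paramSpace =
    (volume : Measure ℝ).prod ((volume : Measure ℝ).prod
      (((volume : Measure ℝ).restrict (Ioi 0)).prod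
        ((volume : Measure (ℝ × ℝ)).restrict (Ioi 0 ×ˢ Ioo (-1) 1)))) := by
  have : paramSpace = univ ×ˢ univ ×ˢ Ioi 0 ×ˢ Ioi 0 ×ˢ Ioo (-1) 1 := by
    ext p; simp [paramSpace]
  have hu : (volume : Measure ℝ) = (volume : Measure ℝ).restrict univ :=
    Measure.restrict_univ.symm
  rw [this, Measure.prod_restrict]
  conv_rhs => rw [hu, Measure.prod_restrict, Measure.prod_restrict]
  rw [Measure.restrict_univ]
  rfl

/-- The order of integration is chosen for what follows: the means innermost, to be integrated out,
and `s` outermost, because the change of variables in `(t, ρ)` depends on it. -/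
theorem lintegral_paramSpace {G : Param → ℝ≥0∞} (hG : Measurable G) :
    ∫⁻ p in paramSpace, G p = ∫⁻ s in Ioi 0, ∫⁻ z in Ioi 0 ×ˢ Ioo (-1) 1,
      ∫⁻ μ₁, ∫⁻ μ₂, G (μ₁, μ₂, s, z) := by
  rw [restrict_paramSpace, lintegral_prod _ hG.aemeasurable]
  set l := ((volume : Measure ℝ).restrict (Ioi 0)).prod
        ((volume : Measure (ℝ × ℝ)).restrict (Ioi 0 ×ˢ Ioo (-1) 1))
  have h1 : ∀ μ₁, ∫⁻ q, G (μ₁, q) ∂(volume.prod l) = ∫⁻ y, (∫⁻ μ₂, G (μ₁, μ₂, y)) ∂l :=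
    fun μ₁ => lintegral_prod_symm' (fun q => G (μ₁, q)) (hG.comp measurable_prodMk_left)
  simp only [h1]
  have hm : Measurable fun q : ℝ × ℝ × ℝ × ℝ => ∫⁻ μ₂, G (q.1, μ₂, q.2) :=
    Measurable.lintegral_prod_right' (f := fun r : (ℝ × ℝ × ℝ × ℝ) × ℝ => G (r.1.1, r.2, r.1.2))
      (by fun_prop)
  rw [lintegral_lintegral_swap hm.aemeasurable]
  have hm2 : Measurable fun y : ℝ × ℝ × ℝ => ∫⁻ μ₁, ∫⁻ μ₂, G (μ₁, μ₂, y) :=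
    Measurable.lintegral_prod_left' hm
  rw [lintegral_prod _ hm2.aemeasurable]

variable {n : ℕ}

theorem measurable_theta1 : Measurable theta1 := by
  unfold theta1; fun_prop

theorem measurable_posteriorDensity (a b : ℝ) (x : Sample n) :
    Measurable fun p => priorDensity a b p * likelihood x p := by
  unfold priorDensity likelihood normalDensity
  fun_prop

theorem gaussianReal_map_const_sub_mul (c : ℝ) (e : ℝ) :
    (gaussianReal 0 1).map (fun z => c - z * e) = gaussianReal c (e ^ 2).toNNReal := by
  have h1 := gaussianReal_map_const_mul (μ := 0) (v := 1) (-e)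
  have h2 := gaussianReal_map_const_add (μ := 0) (v := (e ^ 2).toNNReal) c
  have h3 : NNReal.mk ((-e) ^ 2) (sq_nonneg _) * 1 = (e ^ 2).toNNReal := by
    ext; simp [Real.coe_toNNReal _ (sq_nonneg e)]
  rw [h3, mul_zero] at h1
  rw [← h1, zero_add, Measure.map_map (by fun_prop) (by fun_prop)] at h2
  rw [← h2]
  congr 1
  ext z
  simp only [Function.comp_apply]
  ring

/-- The law of `c - d Z / √V` as a mixture of normal distributions. -/
theorem lintegral_ratio_affine {ν c d s₁₁ D : ℝ} (hν : 0 < ν) (hd : 0 < d) (hs : 0 < s₁₁)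
    (hD : d ^ 2 * s₁₁ = D) :
    ∃ k : ℝ, 0 < k ∧ ∀ f : ℝ → ℝ≥0∞, Measurable f →
      ∫⁻ y, f y ∂(((gaussianReal 0 1).prod (chiSquared ν)).map fun z => c - z.1 / √z.2 * d) =
        ENNReal.ofReal k * ∫⁻ τ in Ioi 0,
          ENNReal.ofReal (τ ^ (-1 - ν) * Real.exp (-(D / (2 * τ ^ 2)))) *
            ∫⁻ θ, gaussianPDF c (τ ^ 2 / s₁₁).toNNReal θ * f θ := by
  have hDpos : 0 < D := by rw [← hD]; positivity
  have := isProbabilityMeasure_chiSquared hν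
  obtain ⟨k, hk, h⟩ := lintegral_chiSquared_eq hν hDpos
  refine ⟨k, hk, fun f hf => ?_⟩
  have hm : Measurable fun z : ℝ × ℝ => f (c - z.1 / √z.2 * d) := by fun_prop
  rw [lintegral_map hf (by fun_prop), lintegral_prod_symm' _ hm, h _ hm.lintegral_prod_left',
    ← lintegral_const_mul' _ _ ENNReal.ofReal_ne_top]
  refine setLIntegral_congr_fun measurableSet_Ioi fun τ hτ => ?_
  have hτ' : 0 < τ := hτ
  simp only
  rw [ENNReal.ofReal_mul hk.le, mul_assoc (ENNReal.ofReal k)]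
  congr 2
  have hv : (τ ^ 2 / s₁₁).toNNReal ≠ 0 := by
    rw [Ne, Real.toNNReal_eq_zero, not_le]; positivity
  -- Since `d√s₁₁ = √D`, conditioning on `V = D/τ²` leaves a normal variable of variance `τ²/s₁₁`.
  have he : ∀ z : ℝ, c - z / √(D / τ ^ 2) * d = c - z * (τ / √s₁₁) := by
    intro z
    rw [Real.sqrt_div' _ (by positivity), Real.sqrt_sq hτ'.le, ← hD, Real.sqrt_mul (by positivity),
      Real.sqrt_sq hd.le]
    have := Real.sqrt_pos.2 hs
    field_simp
  have hmap := gaussianReal_map_const_sub_mul c (τ / √s₁₁)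
  rw [div_pow, Real.sq_sqrt hs.le] at hmap
  simp only [he]
  rw [← lintegral_map (f := f) hf (g := fun z => c - z * (τ / √s₁₁)) (by fun_prop), hmap,
    gaussianReal_of_var_ne_zero _ hv,
    lintegral_withDensity_eq_lintegral_mul _ (measurable_gaussianPDF _ _) hf]
  rfl

/-- A test function of `θ` alone sees the remaining coordinates only through constants and the
mixing over `τ`. The result is a multiple of the mixture in `lintegral_ratio_affine`. -/
theorem lintegral_unnormalizedPosterior (hn : 0 < n) (a b : ℝ) (x : Sample n)
    (h11 : 0 < scatter x 0 0) {f : ℝ → ℝ≥0∞} (hf : Measurable f) :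
    ∫⁻ p, f (theta1 p) ∂unnormalizedPosterior a b x =
      ENNReal.ofReal (regressionConst n (scatter x 0 0)) *
      (∫⁻ s in Ioi 0, ENNReal.ofReal
        (s ^ (-1 - (n - a)) * Real.exp (-(scatter x 0 0 / (2 * s ^ 2))))) *
      ∫⁻ τ in Ioi 0, ENNReal.ofReal (τ ^ (-1 - (n - b)) *
        Real.exp (-((scatter x 1 1 - scatter x 0 1 ^ 2 / scatter x 0 0) / (2 * τ ^ 2)))) *
        ∫⁻ θ, gaussianPDF (scatter x 0 1 / scatter x 0 0) (τ ^ 2 / scatter x 0 0).toNNReal θ *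
          f θ := by
  have hdens := measurable_posteriorDensity a b x
  have hfθ : Measurable fun p => f (theta1 p) := hf.comp measurable_theta1
  rw [unnormalizedPosterior, lintegral_withDensity_eq_lintegral_mul _ hdens.ennreal_ofReal hfθ,
    lintegral_paramSpace (hdens.ennreal_ofReal.mul hfθ)]
  have hn' : (0 : ℝ) < n := by positivity
  set S := scatter x 0 0
  set c := scatter x 0 1 / S
  set D := scatter x 1 1 - scatter x 0 1 ^ 2 / S
  set K := regressionConst n S with hK
  have hK0 : 0 ≤ K := by rw [hK, regressionConst]; positivity
  set A : ℝ → ℝ := fun s => s ^ (-1 - (n - a)) * Real.exp (-(S / (2 * s ^ 2))) with hA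
  set B : ℝ → ℝ := fun τ => τ ^ (-1 - (n - b)) * Real.exp (-(D / (2 * τ ^ 2))) with hB
  have hBm : Measurable B := by rw [hB]; fun_prop
  have hgm : Measurable fun z : ℝ × ℝ => gaussianPDF c (z.1 ^ 2 / S).toNNReal z.2 := by
    unfold gaussianPDF gaussianPDFReal
    fun_prop
  -- the means are integrated out
  have hmeans : ∀ s ∈ Ioi (0 : ℝ), ∀ z ∈ (Ioi 0 ×ˢ Ioo (-1) 1 : Set (ℝ × ℝ)),
      ∫⁻ μ₁, ∫⁻ μ₂, ((fun p => ENNReal.ofReal (priorDensity a b p * likelihood x p)) *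
        fun p => f (theta1 p)) (μ₁, μ₂, s, z) =
      ENNReal.ofReal (z.1 / (s * √(1 - z.2 ^ 2))) * (ENNReal.ofReal (K * A s) *
        (ENNReal.ofReal (B (z.1 * √(1 - z.2 ^ 2))) *
          (gaussianPDF c ((z.1 * √(1 - z.2 ^ 2)) ^ 2 / S).toNNReal (z.2 * z.1 / s) *
            f (z.2 * z.1 / s)))) := by
    rintro s hs ⟨t, ρ⟩ ⟨ht, hρ⟩
    have hs' : 0 < s := hs
    have ht' : 0 < t := ht
    have hw : 0 < √(1 - ρ ^ 2) := Real.sqrt_pos.2 (by nlinarith [hρ.1, hρ.2])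
    have hv1 : (s ^ 2 / n).toNNReal ≠ 0 := by
      rw [Ne, Real.toNNReal_eq_zero, not_le]; positivity
    have hv2 : ((t * √(1 - ρ ^ 2)) ^ 2 / n).toNNReal ≠ 0 := by
      rw [Ne, Real.toNNReal_eq_zero, not_le]; positivity
    have hA0 : 0 ≤ A s := by rw [hA]; positivity
    have hB0 : 0 ≤ B (t * √(1 - ρ ^ 2)) := by rw [hB]; positivity
    set R := ENNReal.ofReal (t / (s * √(1 - ρ ^ 2))) * (ENNReal.ofReal (K * A s) *
        (ENNReal.ofReal (B (t * √(1 - ρ ^ 2))) *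
          (gaussianPDF c ((t * √(1 - ρ ^ 2)) ^ 2 / S).toNNReal (ρ * t / s) *
            f (ρ * t / s)))) with hR
    have hpt : ∀ μ₁ μ₂, ((fun p => ENNReal.ofReal (priorDensity a b p * likelihood x p)) *
        fun p => f (theta1 p)) (μ₁, μ₂, s, t, ρ) =
        R * gaussianPDF (sampleMean x 0) (s ^ 2 / n).toNNReal μ₁ *
        gaussianPDF (sampleMean x 1 + ρ * t / s * (μ₁ - sampleMean x 0))
          ((t * √(1 - ρ ^ 2)) ^ 2 / n).toNNReal μ₂ := by
      intro μ₁ μ₂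
      simp only [Pi.mul_apply]
      rw [priorDensity_mul_likelihood hn a b x hs' ht' hρ h11, ENNReal.ofReal_mul (by positivity),
        ENNReal.ofReal_mul (mul_nonneg (mul_nonneg (mul_nonneg (mul_nonneg hK0 hA0) hB0)
          (gaussianPDFReal_nonneg _ _ _)) (gaussianPDFReal_nonneg _ _ _)),
        ENNReal.ofReal_mul (mul_nonneg (mul_nonneg (mul_nonneg hK0 hA0) hB0)
          (gaussianPDFReal_nonneg _ _ _)),
        ENNReal.ofReal_mul (mul_nonneg (mul_nonneg hK0 hA0) hB0),
        ENNReal.ofReal_mul (mul_nonneg hK0 hA0), hR, theta1]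
      simp only [gaussianPDF]
      ring
    simp only [hpt]
    -- The centre of the `μ₂` density depends on `μ₁`, so `μ₂` is integrated first.
    calc _ = ∫⁻ μ₁, R * gaussianPDF (sampleMean x 0) (s ^ 2 / n).toNNReal μ₁ := by
          refine lintegral_congr fun μ₁ => ?_
          rw [lintegral_const_mul _ (measurable_gaussianPDF _ _), lintegral_gaussianPDF_eq_one _ hv2,
            mul_one]
      _ = R := by
          rw [lintegral_const_mul _ (measurable_gaussianPDF _ _), lintegral_gaussianPDF_eq_one _ hv1,
            mul_one]
  have hinner : ∀ s ∈ Ioi (0 : ℝ), ∫⁻ z in Ioi 0 ×ˢ Ioo (-1) 1,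
      ∫⁻ μ₁, ∫⁻ μ₂, ((fun p => ENNReal.ofReal (priorDensity a b p * likelihood x p)) *
        fun p => f (theta1 p)) (μ₁, μ₂, s, z) =
      ENNReal.ofReal K * ENNReal.ofReal (A s) * ∫⁻ τ in Ioi 0, ENNReal.ofReal (B τ) *
        ∫⁻ θ, gaussianPDF c (τ ^ 2 / S).toNNReal θ * f θ := by
    intro s hs
    rw [setLIntegral_congr_fun (measurableSet_Ioi.prod measurableSet_Ioo) (hmeans s hs),
      ← lintegral_regressionCoords hs (fun z => ENNReal.ofReal (K * A s) *
        (ENNReal.ofReal (B z.1) * (gaussianPDF c (z.1 ^ 2 / S).toNNReal z.2 * f z.2))),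
      lintegral_const_mul _ (by fun_prop), ENNReal.ofReal_mul hK0]
    congr 1
    rw [Measure.volume_eq_prod, ← Measure.prod_restrict, Measure.restrict_univ,
      lintegral_prod _ (by fun_prop)]
    refine lintegral_congr fun τ => ?_
    have hconst := lintegral_const_mul (μ := volume) (ENNReal.ofReal (B τ))
      (f := fun θ => gaussianPDF c (τ ^ 2 / S).toNNReal θ * f θ)
      ((hgm.comp measurable_prodMk_left).mul hf)
    exact hconst
  rw [setLIntegral_congr_fun measurableSet_Ioi hinner,
    lintegral_mul_const _ (by fun_prop), lintegral_const_mul _ (by fun_prop)]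

/-- Up to the constant `k` this is the total mass of a chi-squared law. For `ν = n - a` it is where
`a < n` makes the posterior proper. -/
theorem lintegral_scaleKernel {ν D : ℝ} (hν : 0 < ν) (hD : 0 < D) :
    (∫⁻ s in Ioi 0, ENNReal.ofReal (s ^ (-1 - ν) * Real.exp (-(D / (2 * s ^ 2))))) ≠ 0 ∧
    (∫⁻ s in Ioi 0, ENNReal.ofReal (s ^ (-1 - ν) * Real.exp (-(D / (2 * s ^ 2))))) ≠ ∞ := by
  have := isProbabilityMeasure_chiSquared hν
  obtain ⟨k, hk, h⟩ := lintegral_chiSquared_eq hν hD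
  have h1 := h (fun _ => 1) measurable_const
  simp only [lintegral_const, measure_univ, mul_one, ENNReal.ofReal_mul hk.le] at h1
  rw [lintegral_const_mul' _ _ ENNReal.ofReal_ne_top] at h1
  refine ⟨fun h0 => ?_, fun h0 => ?_⟩
  · rw [h0, mul_zero] at h1
    exact one_ne_zero h1
  · rw [h0, ENNReal.mul_top (by simpa using hk)] at h1
    exact ENNReal.one_ne_top h1

theorem map_theta1_unnormalizedPosterior (hn : 0 < n) {a b : ℝ} (ha : a < n) (hb : b < n)
    (x : Sample n) (h11 : 0 < scatter x 0 0) {d : ℝ} (hd : 0 < d)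
    (hd2 : d ^ 2 * scatter x 0 0 = scatter x 1 1 - scatter x 0 1 ^ 2 / scatter x 0 0) :
    ∃ C : ℝ≥0∞, C ≠ 0 ∧ C ≠ ∞ ∧ (unnormalizedPosterior a b x).map theta1 =
      C • ((gaussianReal 0 1).prod (chiSquared (n - b))).map
        fun z => scatter x 0 1 / scatter x 0 0 - z.1 / √z.2 * d := by
  obtain ⟨k, hk, h⟩ := lintegral_ratio_affine (c := scatter x 0 1 / scatter x 0 0)
    (sub_pos.2 hb) hd h11 hd2
  obtain ⟨hA0, hA⟩ := lintegral_scaleKernel (sub_pos.2 ha) h11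
  have hK : 0 < regressionConst n (scatter x 0 0) := by
    have : (0 : ℝ) < n := by positivity
    rw [regressionConst]; positivity
  have hk0 : ENNReal.ofReal k ≠ 0 := by simpa using hk
  refine ⟨ENNReal.ofReal (regressionConst n (scatter x 0 0)) * _ * (ENNReal.ofReal k)⁻¹,
    mul_ne_zero (mul_ne_zero (by simpa using hK) hA0) (by simp),
    ENNReal.mul_ne_top (ENNReal.mul_ne_top (by simp) hA) (by simpa using hk), ?_⟩
  refine Measure.ext_of_lintegral _ fun f hf => ?_
  rw [lintegral_map hf measurable_theta1, lintegral_unnormalizedPosterior hn a b x h11 hf,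
    lintegral_smul_measure, h f hf, smul_eq_mul, mul_assoc _ (ENNReal.ofReal k)⁻¹, ← mul_assoc _⁻¹,
    ENNReal.inv_mul_cancel hk0 ENNReal.ofReal_ne_top, one_mul]

/-- The posterior is proper, and the posterior distribution of the regression coefficient is that
of `c - d Z / √V`. -/
theorem posterior_proper_and_law (hn : 0 < n) {a b : ℝ} (ha : a < n) (hb : b < n)
    (x : Sample n) (h11 : 0 < scatter x 0 0) {d : ℝ} (hd : 0 < d)
    (hd2 : d ^ 2 * scatter x 0 0 = scatter x 1 1 - scatter x 0 1 ^ 2 / scatter x 0 0) :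
    IsProbabilityMeasure (posterior a b x) ∧ posteriorTheta1 a b x =
      ((gaussianReal 0 1).prod (chiSquared (n - b))).map
        fun z => scatter x 0 1 / scatter x 0 0 - z.1 / √z.2 * d := by
  have := isProbabilityMeasure_chiSquared (sub_pos.2 hb)
  obtain ⟨C, hC0, hC, h⟩ := map_theta1_unnormalizedPosterior hn ha hb x h11 hd hd2
  have : IsProbabilityMeasure (((gaussianReal 0 1).prod (chiSquared (n - b))).map
        fun z : ℝ × ℝ => scatter x 0 1 / scatter x 0 0 - z.1 / √z.2 * d) :=
    Measure.isProbabilityMeasure_map (by fun_prop)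
  have huniv : unnormalizedPosterior a b x univ = C := by
    have := congrArg (fun m => m univ) h
    simpa [Measure.map_apply measurable_theta1 MeasurableSet.univ] using this
  refine ⟨⟨?_⟩, ?_⟩
  · rw [posterior, huniv, Measure.smul_apply, huniv, smul_eq_mul, ENNReal.inv_mul_cancel hC0 hC]
  · rw [posteriorTheta1, posterior, huniv, Measure.map_smul, h, smul_smul,
      ENNReal.inv_mul_cancel hC0 hC, one_smul]

end Posterior

/-! ### Sums of squares of standard normal variables -/

section SumOfSquares

/-- A positive real factor leaves the argument of `z` unchanged, so no branch of the logarithm is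
crossed. -/
theorem ofReal_mul_cpow {r : ℝ} (hr : 0 < r) {z : ℂ} (hz : z ≠ 0) (y : ℂ) :
    ((r : ℂ) * z) ^ y = (r : ℂ) ^ y * z ^ y := by
  have hr' : (r : ℂ) ≠ 0 := Complex.ofReal_ne_zero.2 hr.ne'
  rw [Complex.cpow_def_of_ne_zero (mul_ne_zero hr' hz), Complex.cpow_def_of_ne_zero hr',
    Complex.cpow_def_of_ne_zero hz, Complex.log_ofReal_mul hr hz, add_mul, Complex.exp_add,
    Complex.ofReal_log hr.le]

theorem mgf_chiSquared {ν : ℝ} (hν : 0 < ν) {t : ℝ} (ht : t < 1 / 2) :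
    mgf id (chiSquared ν) t = (1 / 2) ^ (ν / 2) * (1 / (1 / 2 - t)) ^ (ν / 2) := by
  have hr : 0 < 1 / 2 - t := by linarith
  have hG : 0 < Real.Gamma (ν / 2) := Real.Gamma_pos_of_pos (by positivity)
  have h := Real.integral_rpow_mul_exp_neg_mul_Ioi (a := ν / 2) (by positivity) hr
  have hpdf : ∀ v : ℝ, (gammaPDF (ν / 2) (1 / 2) v).toReal = gammaPDFReal (ν / 2) (1 / 2) v :=
    fun v => ENNReal.toReal_ofReal (gammaPDFReal_nonneg (by positivity) (by norm_num) v)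
  rw [mgf, chiSquared, gammaMeasure, integral_withDensity_eq_integral_toReal_smul
    (f := gammaPDF (ν / 2) (1 / 2)) (by unfold gammaPDF; fun_prop)
    (ae_of_all _ fun v => ENNReal.ofReal_lt_top)]
  have h0 : ∀ᵐ v : ℝ, v ∉ Ioi (0 : ℝ) → (gammaPDF (ν / 2) (1 / 2) v).toReal •
      Real.exp (t * id v) = 0 := by
    filter_upwards [compl_mem_ae_iff.2 (measure_singleton (0 : ℝ))] with v hv0 hv
    rw [gammaPDF_of_neg (lt_of_le_of_ne (not_lt.1 hv) hv0), ENNReal.toReal_zero, zero_smul]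
  rw [← setIntegral_eq_integral_of_ae_compl_eq_zero h0]
  have h1 : ∀ v ∈ Ioi (0 : ℝ), (gammaPDF (ν / 2) (1 / 2) v).toReal • Real.exp (t * id v) =
      ((1 / 2) ^ (ν / 2) / Real.Gamma (ν / 2)) *
        (v ^ (ν / 2 - 1) * Real.exp (-((1 / 2 - t) * v))) := by
    intro v hv
    have hv' : 0 < v := hv
    rw [hpdf, gammaPDFReal, if_pos hv'.le, smul_eq_mul, id,
      show -((1 / 2 - t) * v) = -(1 / 2 * v) + t * v by ring, Real.exp_add]
    ring
  rw [setIntegral_congr_fun measurableSet_Ioi h1, integral_const_mul, h]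
  field_simp

/-- The moment generating function is known on the reals below `1/2`. Both sides extend analytically
to the half-plane `re z < 1/2`, so they agree at `z = it`. -/
theorem charFun_chiSquared {ν : ℝ} (hν : 0 < ν) (t : ℝ) :
    charFun (chiSquared ν) t =
      ((1 / 2 : ℝ) : ℂ) ^ ((ν : ℂ) / 2) * (1 / (1 / 2 - t * Complex.I)) ^ ((ν : ℂ) / 2) := by
  have := isProbabilityMeasure_chiSquared hν
  have hint : Iio (1 / 2 : ℝ) ⊆ interior (integrableExpSet id (chiSquared ν)) := by
    refine interior_maximal (fun s hs => ?_) isOpen_Iio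
    have hs' : 0 < 1 / 2 - s := sub_pos.2 hs
    refine mgf_pos_iff.1 ?_
    rw [mgf_chiSquared hν hs]
    positivity
  let U : Set ℂ := {z | z.re < 1 / 2}
  have hf : AnalyticOnNhd ℂ (complexMGF id (chiSquared ν)) U := fun z hz =>
    analyticOnNhd_complexMGF z (hint hz)
  have hg : AnalyticOnNhd ℂ (fun z : ℂ => ((1 / 2 : ℝ) : ℂ) ^ ((ν : ℂ) / 2) *
      (1 / (1 / 2 - z)) ^ ((ν : ℂ) / 2)) U := by
    intro z hz
    have hre : 0 < (1 / 2 - z : ℂ).re := by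
      have : z.re < 1 / 2 := hz
      simpa using this
    have hne : (1 / 2 - z : ℂ) ≠ 0 := fun h => by
      rw [h] at hre
      simp at hre
    refine analyticAt_const.mul (AnalyticAt.cpow ?_ analyticAt_const ?_)
    · exact analyticAt_const.div (analyticAt_const.sub analyticAt_id) hne
    · refine Complex.mem_slitPlane_iff.2 (Or.inl ?_)
      rw [one_div, Complex.inv_re]
      exact div_pos hre (Complex.normSq_pos.2 hne)
  have hU : IsPreconnected U := (convex_halfSpace_re_lt _).isPreconnected
  have hfreq : ∃ᶠ z in 𝓝[≠] (0 : ℂ), complexMGF id (chiSquared ν) z =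
      ((1 / 2 : ℝ) : ℂ) ^ ((ν : ℂ) / 2) * (1 / (1 / 2 - z)) ^ ((ν : ℂ) / 2) := by
    have hT : Tendsto (fun x : ℝ => (x : ℂ)) (𝓝[≠] 0) (𝓝[≠] 0) := by
      refine tendsto_nhdsWithin_of_tendsto_nhds_of_eventually_within _ ?_ ?_
      · exact (Complex.continuous_ofReal.tendsto' 0 0 (by simp)).mono_left nhdsWithin_le_nhds
      · filter_upwards [self_mem_nhdsWithin] with x hx
        simpa using hx
    refine hT.frequently (Eventually.frequently ?_)
    filter_upwards [nhdsWithin_le_nhds (Iio_mem_nhds (show (0 : ℝ) < 1 / 2 by norm_num))] with x hx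
    have hx' : 0 < 1 / 2 - x := sub_pos.2 hx
    rw [complexMGF_ofReal, mgf_chiSquared hν hx, Complex.ofReal_mul,
      Complex.ofReal_cpow (by norm_num), Complex.ofReal_cpow (by positivity)]
    push_cast
    rfl
  have h := hf.eqOn_of_preconnected_of_frequently_eq hg hU (z₀ := 0) (by simp [U]) hfreq
    (show (t * Complex.I : ℂ) ∈ U by simp [U])
  rw [← complexMGF_id_mul_I, h]

/-- This is the complex Gaussian integral with parameter `1/2 - it`, brought to the form of
`charFun_chiSquared` at `ν = 1`. -/
theorem charFun_map_sq_gaussianReal (t : ℝ) :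
    charFun ((gaussianReal 0 1).map fun z => z ^ 2) t =
      ((1 / 2 : ℝ) : ℂ) ^ (1 / 2 : ℂ) * (1 / (1 / 2 - t * Complex.I)) ^ (1 / 2 : ℂ) := by
  have hb : (0 : ℝ) < (1 / 2 - t * Complex.I : ℂ).re := by simp
  have hb0 : (1 / 2 - t * Complex.I : ℂ) ≠ 0 := fun h => by
    rw [h] at hb
    simp at hb
  rw [charFun_apply_real, integral_map (by fun_prop) (by fun_prop),
    integral_gaussianReal_eq_integral_smul one_ne_zero]
  have h1 : ∀ z : ℝ, gaussianPDFReal 0 1 z • Complex.exp (t * ((z ^ 2 : ℝ) : ℂ) * Complex.I) =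
      ((√(2 * Real.pi))⁻¹ : ℝ) * Complex.exp (-(1 / 2 - t * Complex.I) * (z : ℂ) ^ 2) := by
    intro z
    rw [gaussianPDFReal, Complex.real_smul, Complex.ofReal_mul, mul_assoc, Complex.ofReal_exp,
      ← Complex.exp_add]
    simp only [NNReal.coe_one, mul_one, sub_zero]
    congr 2
    push_cast
    ring
  simp only [h1]
  rw [integral_const_mul, integral_gaussian_complex hb, div_eq_mul_one_div (Real.pi : ℂ),
    ofReal_mul_cpow Real.pi_pos (one_div_ne_zero hb0), ← mul_assoc]
  congr 1
  rw [show (1 / 2 : ℂ) = ((1 / 2 : ℝ) : ℂ) by push_cast; rfl,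
    ← Complex.ofReal_cpow Real.pi_pos.le, ← Complex.ofReal_cpow (by norm_num),
    ← Complex.ofReal_mul, ← Real.sqrt_eq_rpow, ← Real.sqrt_eq_rpow]
  congr 1
  rw [Real.sqrt_mul (by norm_num), Real.sqrt_div (by norm_num)]
  have := Real.sqrt_pos.2 Real.pi_pos
  field_simp
  simp

/-- The sum of squares of `m` independent standard normal variables is chi-squared with `m` degrees
of freedom. -/
theorem map_sum_sq_pi_gaussianReal {m : ℕ} (hm : 0 < m) :
    (Measure.pi fun _ : Fin m => gaussianReal 0 1).map (fun w => ∑ i, w i ^ 2) =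
      chiSquared m := by
  have hm' : (0 : ℝ) < m := by positivity
  have := isProbabilityMeasure_chiSquared hm'
  have hsm : Measurable fun w : Fin m → ℝ => ∑ i, w i ^ 2 := by fun_prop
  have : IsProbabilityMeasure ((Measure.pi fun _ : Fin m => gaussianReal 0 1).map
      (fun w => ∑ i, w i ^ 2)) := Measure.isProbabilityMeasure_map hsm.aemeasurable
  refine Measure.ext_of_charFun (funext fun t => ?_)
  rw [charFun_chiSquared hm', charFun_apply_real, integral_map hsm.aemeasurable (by fun_prop)]
  have h1 : ∀ w : Fin m → ℝ, Complex.exp (t * ((∑ i, w i ^ 2 : ℝ) : ℂ) * Complex.I) =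
      ∏ i, Complex.exp (t * ((w i ^ 2 : ℝ) : ℂ) * Complex.I) := by
    intro w
    rw [← Complex.exp_sum, Complex.ofReal_sum, Finset.mul_sum, Finset.sum_mul]
  have h2 := charFun_map_sq_gaussianReal t
  rw [charFun_apply_real, integral_map (by fun_prop) (by fun_prop)] at h2
  simp only [h1]
  rw [integral_fintype_prod_eq_prod (fun (_ : Fin m) (z : ℝ) =>
    Complex.exp (t * ((z ^ 2 : ℝ) : ℂ) * Complex.I)), Finset.prod_const, h2, Finset.card_univ,
    Fintype.card_fin, mul_pow, ← Complex.cpow_nat_mul, ← Complex.cpow_nat_mul]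
  simp [div_eq_mul_inv]

end SumOfSquares

/-! ### Sampling distribution of the regression coefficient -/

section Sampling

/-- The pair is built as a regression on its first coordinate. The minus sign before the error makes
the estimation error of `θ₁` a positive multiple of the cross product in `pivot_sampleOf`. -/
theorem multivariateGaussian_eq_map {p : Param} (hp : p ∈ paramSpace) :
    multivariateGaussian (meanVec p) (covMatrix p) =
      ((gaussianReal 0 1).prod (gaussianReal 0 1)).map fun z =>
        !₂[p.1 + p.2.2.1 * z.1, p.2.1 + p.2.2.2.1 * (p.2.2.2.2 * z.1 -
          √(1 - p.2.2.2.2 ^ 2) * z.2)] := by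
  obtain ⟨μ₁, μ₂, s, t, ρ⟩ := p
  obtain ⟨hs, ht, hρ1, hρ2⟩ := hp
  simp only at hs ht hρ1 hρ2
  have hw2 := Real.sq_sqrt (show 0 ≤ 1 - ρ ^ 2 by nlinarith)
  simp only [meanVec, covMatrix]
  set w := √(1 - ρ ^ 2)
  have hpsd : (!![s ^ 2, ρ * s * t; ρ * s * t, t ^ 2] : Matrix (Fin 2) (Fin 2) ℝ).PosSemidef := by
    -- A Cholesky factor gives the positive semidefiniteness that `charFun_multivariateGaussian`
    -- requires.
    have : (!![s ^ 2, ρ * s * t; ρ * s * t, t ^ 2] : Matrix (Fin 2) (Fin 2) ℝ) =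
        !![s, 0; t * ρ, t * w] * (!![s, 0; t * ρ, t * w]).conjTranspose := by
      ext i j
      fin_cases i <;> fin_cases j <;> simp [Matrix.mul_apply, Fin.sum_univ_two]
      · ring
      · ring
      · ring
      · linear_combination -t ^ 2 * hw2
    rw [this]
    exact Matrix.posSemidef_self_mul_conjTranspose _
  have hmeas : Measurable fun z : ℝ × ℝ =>
      (!₂[μ₁ + s * z.1, μ₂ + t * (ρ * z.1 - w * z.2)] : EuclideanSpace ℝ (Fin 2)) := by
    refine (WithLp.measurable_toLp 2 _).comp (measurable_pi_iff.2 fun i => ?_)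
    fin_cases i <;> simp <;> fun_prop
  have : IsProbabilityMeasure (((gaussianReal 0 1).prod (gaussianReal 0 1)).map fun z : ℝ × ℝ =>
      (!₂[μ₁ + s * z.1, μ₂ + t * (ρ * z.1 - w * z.2)] : EuclideanSpace ℝ (Fin 2))) :=
    Measure.isProbabilityMeasure_map hmeas.aemeasurable
  refine Measure.ext_of_charFun (funext fun y => ?_)
  rw [charFun_multivariateGaussian hpsd, charFun_apply,
    integral_map hmeas.aemeasurable (by fun_prop)]
  have h1 : ∀ z : ℝ × ℝ, Complex.exp ((⟪(!₂[μ₁ + s * z.1, μ₂ + t * (ρ * z.1 - w * z.2)] :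
      EuclideanSpace ℝ (Fin 2)), y⟫ : ℝ) * Complex.I) =
      Complex.exp ((μ₁ * y 0 + μ₂ * y 1 : ℝ) * Complex.I) *
      (Complex.exp ((s * y 0 + t * ρ * y 1 : ℝ) * z.1 * Complex.I) *
      Complex.exp ((-(t * w * y 1) : ℝ) * z.2 * Complex.I)) := by
    intro z
    rw [← Complex.exp_add, ← Complex.exp_add]
    congr 1
    simp only [PiLp.inner_apply, Fin.sum_univ_two]
    simp
    ring
  simp only [h1]
  rw [integral_const_mul, integral_prod_mul (fun a : ℝ => Complex.exp ((s * y 0 + t * ρ * y 1 : ℝ) *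
    a * Complex.I)) (fun a : ℝ => Complex.exp ((-(t * w * y 1) : ℝ) * a * Complex.I)),
    ← charFun_apply_real, ← charFun_apply_real, charFun_gaussianReal, charFun_gaussianReal,
    ← Complex.exp_add, ← Complex.exp_add]
  congr 1
  have hw2' : (w : ℂ) ^ 2 = 1 - (ρ : ℂ) ^ 2 := by exact_mod_cast hw2
  simp only [PiLp.inner_apply, Fin.sum_univ_two]
  simp [Matrix.mulVec, dotProduct, Fin.sum_univ_two]
  linear_combination ((t : ℂ) ^ 2 * (y 1 : ℂ) ^ 2 / 2) * hw2'

variable {n : ℕ}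

/-- The centred cross product `∑ (u_k - ū) (w_k - w̄)`. -/
noncomputable def centredCross (u w : Fin n → ℝ) : ℝ :=
  ∑ k, (u k - (n : ℝ)⁻¹ * ∑ j, u j) * (w k - (n : ℝ)⁻¹ * ∑ j, w j)

theorem sum_sub_mean (hn : 0 < n) (u : Fin n → ℝ) : ∑ k, (u k - (n : ℝ)⁻¹ * ∑ j, u j) = 0 := by
  have : (n : ℝ) ≠ 0 := by positivity
  rw [Finset.sum_sub_distrib, Finset.sum_const, Finset.card_univ, Fintype.card_fin, nsmul_eq_mul,
    mul_inv_cancel_left₀ this, sub_self]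

theorem centredCross_eq (hn : 0 < n) (u w : Fin n → ℝ) :
    centredCross u w = ∑ k, (u k - (n : ℝ)⁻¹ * ∑ j, u j) * w k := by
  simp only [centredCross, mul_sub, Finset.sum_sub_distrib]
  rw [← Finset.sum_mul, sum_sub_mean hn, zero_mul, sub_zero]

theorem centredCross_self (hn : 0 < n) (w : Fin n → ℝ) :
    centredCross w w = ∑ k, w k ^ 2 - (n : ℝ)⁻¹ * (∑ k, w k) ^ 2 := by
  rw [centredCross_eq hn]
  simp only [sub_mul, Finset.sum_sub_distrib, ← Finset.mul_sum]
  simp only [sq]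
  ring

/-- Fisher's decomposition: the regression sum of squares and the residual sum of squares of a
standard normal vector on a fixed regressor are independent. -/
theorem map_regression_pi_gaussianReal {m : ℕ} (hm : 0 < m) {u : Fin (m + 2) → ℝ}
    (hu : 0 < centredCross u u) :
    (Measure.pi fun _ : Fin (m + 2) => gaussianReal 0 1).map (fun w =>
      (centredCross u w / √(centredCross u u),
        centredCross w w - centredCross u w ^ 2 / centredCross u u)) =
      (gaussianReal 0 1).prod (chiSquared m) := by
  have hn : 0 < m + 2 := by omega
  have hN : (0 : ℝ) < ((m + 2 : ℕ) : ℝ) := by positivity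
  set N : ℝ := ((m + 2 : ℕ) : ℝ) with hNdef
  set S := centredCross u u with hS
  have hsN := Real.sqrt_pos.2 hN
  have hsS := Real.sqrt_pos.2 hu
  -- These are the unit vectors along the constants and along the centred regressor, and they are
  -- orthogonal. The coordinates of `w` along them are the scaled mean and the scaled regression
  -- cross product.
  let e₀ : EuclideanSpace ℝ (Fin (m + 2)) := WithLp.toLp 2 fun _ => (√N)⁻¹
  let e₁ : EuclideanSpace ℝ (Fin (m + 2)) :=
    WithLp.toLp 2 fun k => (u k - N⁻¹ * ∑ j, u j) / √S
  have inner₀ : ∀ w : EuclideanSpace ℝ (Fin (m + 2)), ⟪e₀, w⟫ = (∑ k, w k) / √N := by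
    intro w
    simp [e₀, PiLp.inner_apply, ← Finset.sum_mul, div_eq_mul_inv]
  have inner₁ : ∀ w : EuclideanSpace ℝ (Fin (m + 2)), ⟪e₁, w⟫ = centredCross u w / √S := by
    intro w
    rw [centredCross_eq hn, Finset.sum_div, ← hNdef]
    simp only [e₁, PiLp.inner_apply]
    refine Finset.sum_congr rfl fun k _ => ?_
    simp only [RCLike.inner_apply, conj_trivial]
    ring
  have h00 : ‖e₀‖ = 1 := by
    rw [← sq_eq_sq₀ (norm_nonneg _) zero_le_one, ← real_inner_self_eq_norm_sq, inner₀]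
    simp only [e₀, Finset.sum_const, Finset.card_univ, Fintype.card_fin, nsmul_eq_mul, ← hNdef]
    field_simp
    rw [Real.sq_sqrt hN.le]
  have h11 : ‖e₁‖ = 1 := by
    have h : centredCross u (fun k => (u k - N⁻¹ * ∑ j, u j) / √S) = √S := by
      rw [centredCross_eq hn]
      simp only [← mul_div_assoc, ← Finset.sum_div]
      rw [div_eq_iff hsS.ne', Real.mul_self_sqrt hu.le]
      rfl
    rw [← sq_eq_sq₀ (norm_nonneg _) zero_le_one, ← real_inner_self_eq_norm_sq, inner₁]
    simp only [e₁]
    rw [h, div_self hsS.ne', one_pow]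
  have h01 : ⟪e₀, e₁⟫ = 0 := by
    rw [inner₀]
    simp only [e₁, ← Finset.sum_div]
    rw [sum_sub_mean hn, zero_div, zero_div]
  -- Only the indices `0` and `1` are used; the values beyond are filler, and the basis extension
  -- replaces them.
  let v : Fin (m + 2) → EuclideanSpace ℝ (Fin (m + 2)) := Fin.cons e₀ fun _ => e₁
  have hv : Orthonormal ℝ (({0, 1} : Set (Fin (m + 2))).domRestrict v) := by
    have hv0 : v 0 = e₀ := rfl
    have hv1 : v 1 = e₁ := rfl
    refine ⟨?_, ?_⟩
    · rintro ⟨i, rfl | rfl⟩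
      · exact h00
      · exact h11
    · rintro ⟨i, rfl | rfl⟩ ⟨j, rfl | rfl⟩ hij
      · exact absurd rfl hij
      · exact h01
      · exact (real_inner_comm _ _).trans h01
      · exact absurd rfl hij
  obtain ⟨b, hb⟩ := hv.exists_orthonormalBasis_extension_of_card_eq (by simp)
  have hb0 : b 0 = e₀ := hb 0 (by simp)
  have hb1 : b 1 = e₁ := hb 1 (by simp)
  let R : (Fin (m + 2) → ℝ) → Fin (m + 2) → ℝ := fun w => WithLp.ofLp (b.repr (WithLp.toLp 2 w))
  have hR : ∀ w i, R w i = ⟪b i, WithLp.toLp 2 w⟫ := fun w i => b.repr_apply_apply _ _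
  have hRm : Measurable R :=
    (WithLp.measurable_ofLp 2 _).comp (b.repr.continuous.measurable.comp
      (WithLp.measurable_toLp 2 _))
  -- Rotation invariance of the standard Gaussian: the coordinates in the new basis are again
  -- independent standard normals.
  have hRmap : (Measure.pi fun _ : Fin (m + 2) => gaussianReal 0 1).map R =
      Measure.pi fun _ : Fin (m + 2) => gaussianReal 0 1 := by
    have h1 := map_pi_eq_stdGaussian (ι := Fin (m + 2))
    have h2 := stdGaussian_map b.repr
    have h3 : (stdGaussian (EuclideanSpace ℝ (Fin (m + 2)))).map WithLp.ofLp =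
        Measure.pi fun _ : Fin (m + 2) => gaussianReal 0 1 := by
      rw [← h1, Measure.map_map (WithLp.measurable_ofLp 2 _) (WithLp.measurable_toLp 2 _)]
      exact Measure.map_id
    rw [← h3]
    conv_rhs => rw [← h2, ← h1]
    rw [h3, Measure.map_map b.repr.continuous.measurable (WithLp.measurable_toLp 2 _),
      Measure.map_map (WithLp.measurable_ofLp 2 _)
        (b.repr.continuous.measurable.comp (WithLp.measurable_toLp 2 _))]
    rfl
  -- Coordinate `0`, the mean, is discarded and coordinate `1` is the regression term. By Parseval
  -- the other `m` carry the residual sum of squares.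
  let F : (Fin (m + 2) → ℝ) → ℝ × ℝ := fun y => (y 1, ∑ i : Fin m, y i.succ.succ ^ 2)
  have hFm : Measurable F := by fun_prop
  have hcomp : (fun w => (centredCross u w / √S, centredCross w w - centredCross u w ^ 2 / S)) =
      F ∘ R := by
    funext w
    have hr1 : R w 1 = centredCross u w / √S := by rw [hR, hb1, inner₁]
    have hr0 : R w 0 = (∑ k, w k) / √N := by rw [hR, hb0, inner₀]
    have hsum : ∑ i, R w i ^ 2 = ∑ k, w k ^ 2 := by
      simp only [hR]
      rw [b.sum_sq_inner_right, EuclideanSpace.real_norm_sq_eq]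
    rw [Fin.sum_univ_succ, Fin.sum_univ_succ] at hsum
    have h01 : (0 : Fin (m + 1)).succ = 1 := rfl
    rw [h01, hr0, hr1, div_pow, div_pow, Real.sq_sqrt hN.le, Real.sq_sqrt hu.le] at hsum
    refine Prod.ext hr1.symm ?_
    simp only [F, Function.comp_apply]
    rw [centredCross_self hn]
    linear_combination -hsum
  rw [hcomp, ← Measure.map_map hFm hRm, hRmap]
  have hp1 := (measurePreserving_piFinSuccAbove (fun _ : Fin (m + 2) => gaussianReal 0 1) 0)
  have hp2 := (measurePreserving_piFinSuccAbove (fun _ : Fin (m + 1) => gaussianReal 0 1) 0)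
  have hp3 := (measurePreserving_snd (μ := gaussianReal 0 1)
    (ν := Measure.pi fun _ : Fin (m + 1) => gaussianReal 0 1))
  have hp4 : MeasurePreserving (fun w : Fin m → ℝ => ∑ i, w i ^ 2)
      (Measure.pi fun _ : Fin m => gaussianReal 0 1) (chiSquared m) :=
    ⟨by fun_prop, map_sum_sq_pi_gaussianReal hm⟩
  have := isProbabilityMeasure_chiSquared (ν := m) (by positivity)
  have h := ((((MeasurePreserving.id (gaussianReal 0 1)).prod hp4).comp hp2).comp hp3).comp hp1
  exact h.map_eq

end Sampling

/-! ### Quantiles of the posterior distribution -/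

section PosteriorQuantile

variable {n : ℕ} {a b : ℝ}

theorem posteriorTheta1_eq_map_ratioLaw (hn : 0 < n) (ha : a < n) (hb : b < n) (x : Sample n)
    (h11 : 0 < scatter x 0 0) {d : ℝ} (hd : 0 < d)
    (hd2 : d ^ 2 * scatter x 0 0 = scatter x 1 1 - scatter x 0 1 ^ 2 / scatter x 0 0) :
    posteriorTheta1 a b x =
      (ratioLaw (n - b)).map fun y => scatter x 0 1 / scatter x 0 0 + d * y := by
  rw [(posterior_proper_and_law hn ha hb x h11 hd hd2).2, ← map_const_sub_ratioLaw (sub_pos.2 hb),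
    ratioLaw, Measure.map_map (by fun_prop) (by fun_prop)]
  rfl

theorem quantile_posteriorTheta1 (hn : 0 < n) (ha : a < n) (hb : b < n) (x : Sample n)
    (h11 : 0 < scatter x 0 0) {d : ℝ} (hd : 0 < d)
    (hd2 : d ^ 2 * scatter x 0 0 = scatter x 1 1 - scatter x 0 1 ^ 2 / scatter x 0 0) {u : ℝ}
    (hu : u ∈ Ioo (0 : ℝ) 1) :
    quantile (posteriorTheta1 a b x) u =
      scatter x 0 1 / scatter x 0 0 + d * quantile (ratioLaw (n - b)) u := by
  have hν := sub_pos.2 hb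
  have := isProbabilityMeasure_ratioLaw hν
  have := nullSingletonClass_ratioLaw hν
  have := isOpenPosMeasure_ratioLaw hν
  rw [posteriorTheta1_eq_map_ratioLaw hn ha hb x h11 hd hd2, quantile_map_affine _ hd hu]

theorem posteriorTheta1_Iio_eq_iff (hn : 0 < n) (ha : a < n) (hb : b < n) (x : Sample n)
    (h11 : 0 < scatter x 0 0) {d : ℝ} (hd : 0 < d)
    (hd2 : d ^ 2 * scatter x 0 0 = scatter x 1 1 - scatter x 0 1 ^ 2 / scatter x 0 0) {u : ℝ}
    (hu : u ∈ Ioo (0 : ℝ) 1) (q : ℝ) :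
    (posteriorTheta1 a b x).real (Iio q) = u ↔ q = quantile (posteriorTheta1 a b x) u := by
  have hν := sub_pos.2 hb
  have := isProbabilityMeasure_ratioLaw hν
  have := nullSingletonClass_ratioLaw hν
  have := isOpenPosMeasure_ratioLaw hν
  rw [posteriorTheta1_eq_map_ratioLaw hn ha hb x h11 hd hd2]
  have := nullSingletonClass_map_affine (m := ratioLaw (n - b)) (scatter x 0 1 / scatter x 0 0) hd
  have := isOpenPosMeasure_map_affine (m := ratioLaw (n - b)) (scatter x 0 1 / scatter x 0 0) hd
  have : IsProbabilityMeasure ((ratioLaw (n - b)).map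
      fun y => scatter x 0 1 / scatter x 0 0 + d * y) :=
    Measure.isProbabilityMeasure_map (by fun_prop)
  exact measureReal_Iio_eq_iff hu q

theorem sampleCorr_scale (x : Sample n) (h11 : 0 < scatter x 0 0) (h22 : 0 < scatter x 1 1) :
    sampleCorr x * √(scatter x 1 1) / √(scatter x 0 0) = scatter x 0 1 / scatter x 0 0 := by
  have h1 := Real.sqrt_pos.2 h11
  have h2 := Real.sqrt_pos.2 h22
  have h3 := Real.mul_self_sqrt h11.le
  rw [sampleCorr, Real.sqrt_mul h11.le]
  conv_rhs => rw [← h3]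
  field_simp

/-- The residual sum of squares is `s₂₂(1 - r²)`, so the scale in the statement is the `d` of the
posterior lemmas. -/
theorem residual_scale (x : Sample n) (h11 : 0 < scatter x 0 0) (h22 : 0 < scatter x 1 1)
    (hr : |sampleCorr x| < 1) :
    0 < √(1 - sampleCorr x ^ 2) * √(scatter x 1 1) / √(scatter x 0 0) ∧
    (√(1 - sampleCorr x ^ 2) * √(scatter x 1 1) / √(scatter x 0 0)) ^ 2 * scatter x 0 0 =
      scatter x 1 1 - scatter x 0 1 ^ 2 / scatter x 0 0 := by
  have hpos : 0 < 1 - sampleCorr x ^ 2 := sub_pos.2 ((sq_lt_one_iff_abs_lt_one _).2 hr)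
  refine ⟨by positivity, ?_⟩
  rw [div_pow, mul_pow, Real.sq_sqrt hpos.le, Real.sq_sqrt h11.le, Real.sq_sqrt h22.le, sampleCorr,
    div_pow, Real.sq_sqrt (mul_pos h11 h22).le]
  field_simp

end PosteriorQuantile

/-! ### Frequentist coverage -/

section Coverage

variable {n : ℕ}

/-- A sample with parameter `p` built from standardized regressor values `u` and errors `w`. -/
noncomputable def sampleOf (p : Param) (z : (Fin n → ℝ) × (Fin n → ℝ)) : Sample n := fun k =>
  !₂[p.1 + p.2.2.1 * z.1 k, p.2.1 + p.2.2.2.1 * (p.2.2.2.2 * z.1 k -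
    √(1 - p.2.2.2.2 ^ 2) * z.2 k)]

theorem measurable_sampleOf (p : Param) : Measurable (sampleOf (n := n) p) := by
  refine measurable_pi_iff.2 fun k =>
    (WithLp.measurable_toLp 2 _).comp (measurable_pi_iff.2 fun i => ?_)
  fin_cases i <;> simp <;> fun_prop

/-- Regrouping the pairs into a regressor vector and an independent error vector makes it possible
to condition on the regressors. -/
theorem sampleLaw_eq_map {p : Param} (hp : p ∈ paramSpace) :
    sampleLaw n p = ((Measure.pi fun _ : Fin n => gaussianReal 0 1).prod
      (Measure.pi fun _ : Fin n => gaussianReal 0 1)).map (sampleOf p) := by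
  have hmeas : Measurable fun z : ℝ × ℝ =>
      (!₂[p.1 + p.2.2.1 * z.1, p.2.1 + p.2.2.2.1 * (p.2.2.2.2 * z.1 -
        √(1 - p.2.2.2.2 ^ 2) * z.2)] : EuclideanSpace ℝ (Fin 2)) := by
    refine (WithLp.measurable_toLp 2 _).comp (measurable_pi_iff.2 fun i => ?_)
    fin_cases i <;> simp <;> fun_prop
  have := Measure.isProbabilityMeasure_map (μ := (gaussianReal 0 1).prod (gaussianReal 0 1))
    hmeas.aemeasurable
  have h := (measurePreserving_arrowProdEquivProdArrow ℝ ℝ (Fin n) (fun _ => gaussianReal 0 1)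
    (fun _ => gaussianReal 0 1)).map_eq
  rw [sampleLaw, multivariateGaussian_eq_map hp,
    ← Measure.pi_map_pi (fun _ => hmeas.aemeasurable), ← h,
    Measure.map_map (measurable_sampleOf p) (MeasurableEquiv.measurable _)]
  rfl

theorem sampleOf_sub_sampleMean_zero (hn : 0 < n) (p : Param) (z : (Fin n → ℝ) × (Fin n → ℝ))
    (k : Fin n) : sampleOf p z k 0 - sampleMean (sampleOf p z) 0 =
      p.2.2.1 * (z.1 k - (n : ℝ)⁻¹ * ∑ j, z.1 j) := by
  have : (n : ℝ) ≠ 0 := by positivity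
  simp only [sampleMean, sampleOf]
  simp only [Matrix.cons_val_zero, Finset.sum_add_distrib, ← Finset.mul_sum, Finset.sum_const,
    Finset.card_univ, Fintype.card_fin, nsmul_eq_mul]
  field_simp
  ring

theorem sampleOf_sub_sampleMean_one (hn : 0 < n) (p : Param) (z : (Fin n → ℝ) × (Fin n → ℝ))
    (k : Fin n) : sampleOf p z k 1 - sampleMean (sampleOf p z) 1 =
      p.2.2.2.1 * (p.2.2.2.2 * (z.1 k - (n : ℝ)⁻¹ * ∑ j, z.1 j) -
        √(1 - p.2.2.2.2 ^ 2) * (z.2 k - (n : ℝ)⁻¹ * ∑ j, z.2 j)) := by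
  have : (n : ℝ) ≠ 0 := by positivity
  simp only [sampleMean, sampleOf]
  simp only [Matrix.cons_val_one, Matrix.cons_val_fin_one, Finset.sum_add_distrib,
    Finset.sum_sub_distrib, ← Finset.mul_sum, Finset.sum_const,
    Finset.card_univ, Fintype.card_fin, nsmul_eq_mul]
  field_simp
  ring

theorem scatter_sampleOf (hn : 0 < n) (p : Param) (z : (Fin n → ℝ) × (Fin n → ℝ)) :
    scatter (sampleOf p z) 0 0 = p.2.2.1 ^ 2 * centredCross z.1 z.1 ∧
    scatter (sampleOf p z) 0 1 = p.2.2.1 * p.2.2.2.1 * (p.2.2.2.2 * centredCross z.1 z.1 -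
      √(1 - p.2.2.2.2 ^ 2) * centredCross z.1 z.2) ∧
    scatter (sampleOf p z) 1 1 = p.2.2.2.1 ^ 2 * (p.2.2.2.2 ^ 2 * centredCross z.1 z.1 -
      2 * p.2.2.2.2 * √(1 - p.2.2.2.2 ^ 2) * centredCross z.1 z.2 +
      √(1 - p.2.2.2.2 ^ 2) ^ 2 * centredCross z.2 z.2) := by
  simp only [scatter, sampleOf_sub_sampleMean_zero hn, sampleOf_sub_sampleMean_one hn,
    centredCross, Finset.mul_sum, ← Finset.sum_sub_distrib, ← Finset.sum_add_distrib]
  refine ⟨?_, ?_, ?_⟩ <;> refine Finset.sum_congr rfl fun k _ => ?_ <;> ring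

theorem measurable_centredCross :
    Measurable fun z : (Fin n → ℝ) × (Fin n → ℝ) => centredCross z.1 z.2 := by
  unfold centredCross
  fun_prop

theorem measurable_regression (u : Fin n → ℝ) : Measurable fun w : Fin n → ℝ =>
    (centredCross u w / √(centredCross u u),
      centredCross w w - centredCross u w ^ 2 / centredCross u u) := by
  unfold centredCross
  fun_prop

theorem ae_residual_pos {m : ℕ} (hm : 0 < m) {u : Fin (m + 2) → ℝ} (hu : 0 < centredCross u u) :
    ∀ᵐ w ∂Measure.pi fun _ : Fin (m + 2) => gaussianReal 0 1,
      0 < centredCross w w - centredCross u w ^ 2 / centredCross u u := by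
  have := isProbabilityMeasure_chiSquared (ν := m) (by positivity)
  have h : ∀ᵐ y ∂(gaussianReal 0 1).prod (chiSquared m), 0 < y.2 :=
    Measure.quasiMeasurePreserving_snd.ae (ae_chiSquared_pos m)
  rw [← map_regression_pi_gaussianReal hm hu] at h
  exact ae_of_ae_map (measurable_regression u).aemeasurable h

/-- The centred sum of squares dominates the residual one for any fixed regressor, and the latter is
almost surely positive. A coordinate vector serves as regressor, its centred sum of squares being `1
- 1/(m+2)`. -/
theorem ae_centredCross_self_pos {m : ℕ} (hm : 0 < m) :
    ∀ᵐ w ∂Measure.pi fun _ : Fin (m + 2) => gaussianReal 0 1, 0 < centredCross w w := by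
  have hu : 0 < centredCross (Pi.single 0 1 : Fin (m + 2) → ℝ) (Pi.single 0 1) := by
    rw [centredCross_self (by omega)]
    have h1 : ∑ k, (Pi.single 0 1 : Fin (m + 2) → ℝ) k ^ 2 = 1 := by
      rw [Finset.sum_eq_single 0] <;> simp +contextual
    rw [h1, Finset.sum_pi_single']
    simp only [Finset.mem_univ, if_true, one_pow, mul_one, sub_pos]
    exact inv_lt_one_of_one_lt₀ (by push_cast; linarith [Nat.cast_nonneg (α := ℝ) m])
  filter_upwards [ae_residual_pos hm hu] with w hw
  have : 0 ≤ centredCross (Pi.single 0 1 : Fin (m + 2) → ℝ) w ^ 2 /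
    centredCross (Pi.single 0 1 : Fin (m + 2) → ℝ) (Pi.single 0 1) := by positivity
  linarith

theorem residual_sampleOf (hn : 0 < n) {p : Param} (hp : p ∈ paramSpace)
    {z : (Fin n → ℝ) × (Fin n → ℝ)} (hz : 0 < centredCross z.1 z.1) :
    scatter (sampleOf p z) 1 1 - scatter (sampleOf p z) 0 1 ^ 2 / scatter (sampleOf p z) 0 0 =
      (p.2.2.2.1 * √(1 - p.2.2.2.2 ^ 2)) ^ 2 *
        (centredCross z.2 z.2 - centredCross z.1 z.2 ^ 2 / centredCross z.1 z.1) := by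
  obtain ⟨h00, h01, h11⟩ := scatter_sampleOf hn p z
  have hs : 0 < p.2.2.1 := hp.1
  rw [h00, h01, h11]
  field_simp
  ring

/-- The standardized error of the least squares estimator is pivotal. -/
theorem pivot_sampleOf (hn : 0 < n) {p : Param} (hp : p ∈ paramSpace)
    {z : (Fin n → ℝ) × (Fin n → ℝ)} (hz : 0 < centredCross z.1 z.1) :
    (theta1 p - scatter (sampleOf p z) 0 1 / scatter (sampleOf p z) 0 0) /
      √((scatter (sampleOf p z) 1 1 - scatter (sampleOf p z) 0 1 ^ 2 /
        scatter (sampleOf p z) 0 0) / scatter (sampleOf p z) 0 0) =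
      centredCross z.1 z.2 / √(centredCross z.1 z.1) /
        √(centredCross z.2 z.2 - centredCross z.1 z.2 ^ 2 / centredCross z.1 z.1) := by
  have hs : 0 < p.2.2.1 := hp.1
  have ht : 0 < p.2.2.2.1 := hp.2.1
  have hw : 0 < √(1 - p.2.2.2.2 ^ 2) := Real.sqrt_pos.2 (by nlinarith [hp.2.2.1, hp.2.2.2])
  rw [residual_sampleOf hn hp hz]
  obtain ⟨h00, h01, -⟩ := scatter_sampleOf hn p z
  rw [h00, h01, theta1]
  set s := p.2.2.1
  set t := p.2.2.2.1
  set ρ := p.2.2.2.2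
  set ω := √(1 - ρ ^ 2)
  set S := centredCross z.1 z.1
  set D := centredCross z.2 z.2 - centredCross z.1 z.2 ^ 2 / S
  have hS := Real.sqrt_pos.2 hz
  have hS2 := Real.mul_self_sqrt hz.le
  have e1 : (t * ω) ^ 2 * D / (s ^ 2 * S) = (t * ω / s) ^ 2 * (D / S) := by field_simp
  have e2 : ρ * t / s - s * t * (ρ * S - ω * centredCross z.1 z.2) / (s ^ 2 * S) =
      t * ω / s * (centredCross z.1 z.2 / S) := by
    field_simp
    ring
  rw [e1, e2, Real.sqrt_mul (sq_nonneg _), Real.sqrt_sq (by positivity), Real.sqrt_div' _ hz.le,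
    mul_div_mul_left _ _ (by positivity), div_div_eq_mul_div, div_mul_eq_mul_div]
  congr 1
  rw [div_eq_div_iff hz.ne' hS.ne', mul_assoc, hS2]

/-- The coverage in terms of the law of `Z / √V`. -/
theorem coverage_eq (hn : 3 ≤ n) {a b α : ℝ} (ha : a < n) (hb : b < n) (hα : α ∈ Ioo (0 : ℝ) 1)
    {p : Param} (hp : p ∈ paramSpace) :
    coverage n a b α p =
      (ratioLaw (n - 2)).real (Iio (quantile (ratioLaw (n - b)) (1 - α))) := by
  -- Here `m ≥ 1` is the number of residual degrees of freedom, two being lost to the mean and the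
  -- slope.
  obtain ⟨m, rfl⟩ : ∃ m, n = m + 2 := ⟨n - 2, by omega⟩
  have hm : 0 < m := by omega
  have hn0 : 0 < m + 2 := by omega
  have hu : 1 - α ∈ Ioo (0 : ℝ) 1 := ⟨by linarith [hα.2], by linarith [hα.1]⟩
  have hcast : ((m + 2 : ℕ) : ℝ) - 2 = m := by push_cast; ring
  rw [hcast]
  have hw : 0 < √(1 - p.2.2.2.2 ^ 2) := Real.sqrt_pos.2 (by nlinarith [hp.2.2.1, hp.2.2.2])
  have hs : 0 < p.2.2.1 := hp.1
  have ht : 0 < p.2.2.2.1 := hp.2.1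
  set q := quantile (ratioLaw (((m + 2 : ℕ) : ℝ) - b)) (1 - α)
  set P := Measure.pi fun _ : Fin (m + 2) => gaussianReal 0 1
  have hscat : ∀ i j, Measurable fun x : Sample (m + 2) => scatter x i j := by
    intro i j
    unfold scatter sampleMean
    fun_prop
  have h00m := hscat 0 0
  have h01m := hscat 0 1
  have h11m := hscat 1 1
  -- The posterior quantile formula needs a nondegenerate sample; the exceptional samples form a
  -- null set.
  have hgood : ∀ᵐ x ∂sampleLaw (m + 2) p, 0 < scatter x 0 0 ∧
      0 < scatter x 1 1 - scatter x 0 1 ^ 2 / scatter x 0 0 := by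
    have hgoodm : MeasurableSet {x : Sample (m + 2) | 0 < scatter x 0 0 ∧
        0 < scatter x 1 1 - scatter x 0 1 ^ 2 / scatter x 0 0} :=
      (measurableSet_lt measurable_const h00m).inter
        (measurableSet_lt measurable_const (h11m.sub ((h01m.pow_const 2).div h00m)))
    rw [sampleLaw_eq_map hp, ae_map_iff (measurable_sampleOf p).aemeasurable hgoodm]
    have hSm : Measurable fun z : (Fin (m + 2) → ℝ) × (Fin (m + 2) → ℝ) =>
        centredCross z.1 z.1 :=
      measurable_centredCross.comp (measurable_fst.prodMk measurable_fst)
    have hWm : Measurable fun z : (Fin (m + 2) → ℝ) × (Fin (m + 2) → ℝ) =>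
        centredCross z.2 z.2 :=
      measurable_centredCross.comp (measurable_snd.prodMk measurable_snd)
    have hmain : ∀ᵐ z ∂P.prod P, 0 < centredCross z.1 z.1 ∧
        0 < centredCross z.2 z.2 - centredCross z.1 z.2 ^ 2 / centredCross z.1 z.1 := by
      have hmainm : MeasurableSet {z : (Fin (m + 2) → ℝ) × (Fin (m + 2) → ℝ) |
          0 < centredCross z.1 z.1 ∧
          0 < centredCross z.2 z.2 - centredCross z.1 z.2 ^ 2 / centredCross z.1 z.1} :=
        (measurableSet_lt measurable_const hSm).inter (measurableSet_lt measurable_const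
          (hWm.sub ((measurable_centredCross.pow_const 2).div hSm)))
      rw [Measure.ae_prod_iff_ae_ae hmainm]
      filter_upwards [ae_centredCross_self_pos hm] with u hu
      filter_upwards [ae_residual_pos hm hu] with w hw
      exact ⟨hu, hw⟩
    filter_upwards [hmain] with z hz
    rw [residual_sampleOf hn0 hp hz.1, (scatter_sampleOf hn0 p z).1]
    exact ⟨mul_pos (by positivity) hz.1, mul_pos (by positivity) hz.2⟩
  have hset : {x : Sample (m + 2) | theta1 p < quantile (posteriorTheta1 a b x) (1 - α)}
      =ᵐ[sampleLaw (m + 2) p] {x | (theta1 p - scatter x 0 1 / scatter x 0 0) /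
        √((scatter x 1 1 - scatter x 0 1 ^ 2 / scatter x 0 0) / scatter x 0 0) < q} := by
    refine eventuallyEq_set.2 ?_
    filter_upwards [hgood] with x hx
    have hd : 0 < √((scatter x 1 1 - scatter x 0 1 ^ 2 / scatter x 0 0) / scatter x 0 0) :=
      Real.sqrt_pos.2 (div_pos hx.2 hx.1)
    have hd2 : √((scatter x 1 1 - scatter x 0 1 ^ 2 / scatter x 0 0) / scatter x 0 0) ^ 2 *
        scatter x 0 0 = scatter x 1 1 - scatter x 0 1 ^ 2 / scatter x 0 0 := by
      rw [Real.sq_sqrt (div_pos hx.2 hx.1).le, div_mul_cancel₀ _ hx.1.ne']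
    rw [quantile_posteriorTheta1 hn0 ha hb x hx.1 hd hd2 hu,
      div_lt_iff₀ hd, sub_lt_iff_lt_add', mul_comm q]
  have hmeas : MeasurableSet {x : Sample (m + 2) | (theta1 p - scatter x 0 1 / scatter x 0 0) /
        √((scatter x 1 1 - scatter x 0 1 ^ 2 / scatter x 0 0) / scatter x 0 0) < q} :=
    measurableSet_lt (by fun_prop) measurable_const
  rw [coverage, measureReal_def, measure_congr hset, sampleLaw_eq_map hp,
    Measure.map_apply (measurable_sampleOf p) hmeas,
    Measure.prod_apply (measurable_sampleOf p hmeas), measureReal_def]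
  congr 1
  -- Given the regressors `u`, the pivot has law `ratioLaw m`. This does not depend on `u`, so the
  -- outer integral is that of a constant.
  have hconst : ∀ᵐ u ∂P, P (Prod.mk u ⁻¹' (sampleOf p ⁻¹' {x : Sample (m + 2) |
      (theta1 p - scatter x 0 1 / scatter x 0 0) /
        √((scatter x 1 1 - scatter x 0 1 ^ 2 / scatter x 0 0) / scatter x 0 0) < q})) =
      ratioLaw m (Iio q) := by
    filter_upwards [ae_centredCross_self_pos hm] with u hu
    have hratio : Measurable fun y : ℝ × ℝ => y.1 / √y.2 := by fun_prop
    rw [ratioLaw, ← map_regression_pi_gaussianReal hm hu,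
      Measure.map_map hratio (measurable_regression u),
      Measure.map_apply (hratio.comp (measurable_regression u)) measurableSet_Iio]
    congr 1
    ext w
    simp only [mem_preimage, mem_ofPred_eq, mem_Iio, Function.comp_apply]
    rw [pivot_sampleOf (z := (u, w)) hn0 hp hu]
  rw [lintegral_congr_ae hconst, lintegral_const, measure_univ, mul_one]

theorem studentT_scaled_quantile {ν ν' u : ℝ} (hν : 0 < ν) (hν' : 0 < ν')
    (hu : u ∈ Ioo (0 : ℝ) 1) :
    (studentT ν).real (Iio (√(ν / ν') * quantile (studentT ν') u)) =
      (ratioLaw ν).real (Iio (quantile (ratioLaw ν') u)) := by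
  have := isProbabilityMeasure_ratioLaw hν'
  have := nullSingletonClass_ratioLaw hν'
  have := isOpenPosMeasure_ratioLaw hν'
  have hs := Real.sqrt_pos.2 hν'
  rw [studentT_eq_map_ratioLaw hν, studentT_eq_map_ratioLaw hν',
    quantile_map_affine 0 hs hu]
  have h : √(ν / ν') * (0 + √ν' * quantile (ratioLaw ν') u) =
      0 + √ν * quantile (ratioLaw ν') u := by
    rw [Real.sqrt_div hν.le]
    field_simp
    ring
  rw [h, measureReal_map_affine_Iio 0 (Real.sqrt_pos.2 hν)]

/-- The level `1 - α` is itself the value of the `ν'` distribution function at the quantile, so two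
distribution functions are compared at one point. By symmetry that point is `0` exactly when `α =
1/2`. -/
theorem ratioLaw_quantile_eq_iff {ν ν' α : ℝ} (hν : 0 < ν) (hν' : 0 < ν')
    (hα : α ∈ Ioo (0 : ℝ) 1) :
    (ratioLaw ν).real (Iio (quantile (ratioLaw ν') (1 - α))) = 1 - α ↔ ν = ν' ∨ α = 1 / 2 := by
  have := isProbabilityMeasure_ratioLaw hν'
  have := nullSingletonClass_ratioLaw hν'
  have := isOpenPosMeasure_ratioLaw hν'
  have hu : 1 - α ∈ Ioo (0 : ℝ) 1 := ⟨by linarith [hα.2], by linarith [hα.1]⟩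
  have hq := measureReal_Iio_quantile (m := ratioLaw ν') hu
  have h0 : quantile (ratioLaw ν') (1 - α) = 0 ↔ α = 1 / 2 := by
    rw [eq_comm, ← measureReal_Iio_eq_iff hu, measureReal_ratioLaw_Iio_zero hν']
    constructor <;> intro h <;> linarith
  rw [← h0, ← measureReal_ratioLaw_Iio_eq_iff hν hν', hq]

end Coverage

end BivariateNormal

theorem theorem4 (n : ℕ) (hn : 3 ≤ n) (a b : ℝ) (ha : a < n) (hb : b < n) :
    (∀ x : BivariateNormal.Sample n,
      0 < BivariateNormal.scatter x 0 0 → 0 < BivariateNormal.scatter x 1 1 →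
      |BivariateNormal.sampleCorr x| < 1 →
      IsProbabilityMeasure (BivariateNormal.posterior a b x) ∧
      BivariateNormal.posteriorTheta1 a b x =
        ((gaussianReal 0 1).prod (BivariateNormal.chiSquared (n - b))).map (fun z =>
          BivariateNormal.sampleCorr x * √(BivariateNormal.scatter x 1 1)
              / √(BivariateNormal.scatter x 0 0)
            - z.1 / √z.2 *
              (√(1 - BivariateNormal.sampleCorr x ^ 2) * √(BivariateNormal.scatter x 1 1)
                / √(BivariateNormal.scatter x 0 0))) ∧
      ∀ α ∈ Set.Ioo (0 : ℝ) 1, ∀ q : ℝ,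
        (BivariateNormal.posteriorTheta1 a b x).real (Set.Iio q) = 1 - α ↔
          q = BivariateNormal.quantile (BivariateNormal.posteriorTheta1 a b x) (1 - α)) ∧
    (∀ p ∈ BivariateNormal.paramSpace,
      (∀ α ∈ Set.Ioo (0 : ℝ) 1,
        BivariateNormal.coverage n a b α p =
          (BivariateNormal.studentT (n - 2)).real
            (Set.Iio (√((n - 2) / (n - b)) *
              BivariateNormal.quantile (BivariateNormal.studentT (n - b)) (1 - α))) ∧
        (BivariateNormal.coverage n a b α p = 1 - α ↔ b = 2 ∨ α = 1 / 2)) ∧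
      ((∀ α ∈ Set.Ioo (0 : ℝ) 1, BivariateNormal.coverage n a b α p = 1 - α) ↔ b = 2)) := by
  have hn0 : 0 < n := by omega
  have hn2 : (0 : ℝ) < n - 2 := by
    have : (3 : ℝ) ≤ n := by exact_mod_cast hn
    linarith
  have hnb := sub_pos.2 hb
  refine ⟨fun x h11 h22 hr => ?_, fun p hp => ?_⟩
  · obtain ⟨hd, hd2⟩ := BivariateNormal.residual_scale x h11 h22 hr
    obtain ⟨hproper, hlaw⟩ := BivariateNormal.posterior_proper_and_law hn0 ha hb x h11 hd hd2
    refine ⟨hproper, ?_, fun α hα q => ?_⟩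
    · rw [hlaw, BivariateNormal.sampleCorr_scale x h11 h22]
    · exact BivariateNormal.posteriorTheta1_Iio_eq_iff hn0 ha hb x h11 hd hd2
        ⟨by linarith [hα.2], by linarith [hα.1]⟩ q
  · have hcov : ∀ α ∈ Set.Ioo (0 : ℝ) 1,
        (BivariateNormal.coverage n a b α p = 1 - α ↔ b = 2 ∨ α = 1 / 2) := by
      intro α hα
      rw [BivariateNormal.coverage_eq hn ha hb hα hp,
        BivariateNormal.ratioLaw_quantile_eq_iff hn2 hnb hα]
      refine or_congr_left ⟨fun h => by linarith, fun h => by rw [h]⟩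
    refine ⟨fun α hα => ⟨?_, hcov α hα⟩, fun h => ?_, fun h α hα => (hcov α hα).2 (Or.inl h)⟩
    · rw [BivariateNormal.coverage_eq hn ha hb hα hp,
        BivariateNormal.studentT_scaled_quantile hn2 hnb ⟨by linarith [hα.2], by linarith [hα.1]⟩]
    -- Any level other than `1/2` would force `b = 2`.
    · have hα : (1 / 4 : ℝ) ∈ Set.Ioo (0 : ℝ) 1 := by norm_num
      refine ((hcov _ hα).1 (h _ hα)).resolve_right ?_
      norm_num
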